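/- Let $p$ be a prime, $K=\mathbb F_p(Y)$, $R_\infty=\mathbb F_p[Y]$, $K_\infty=\mathbb F_p((Y^{-1}))$, and let $X_\infty=\mathrm{PGL}_2(K_\infty)/\mathrm{PGL}_2(R_\infty)$ be the space of homothety classes of $R_\infty$-lattices in $K_\infty^2$. Let $A_\infty$ be the diagonal subgroup of $\mathrm{PGL}_2(K_\infty)$. A point $x\in X_\infty$ is $A_\infty$-periodic if its orbit $A_\infty x$ is compact, and then $\mu_x$ denotes the unique $A_\infty$-invariant probability measure on this orbit. For a prime polynomial $\nu\in R_\infty$, join two points of $X_\infty$ by an edge if they are the classes of lattices $\Lambda'\subset\Lambda$ with $\Lambda/\Lambda'\simeq R_\infty/\nu R_\infty$. The connected component of a point $x_0$ is a tree, the Hecke tree $T_\nu(x_0)$. Writing $x_0=[gR_\infty^2]$ with $g\in\mathrm{GL}_2(K_\infty)$, the map $[\gamma O_\nu^2]\mapsto[g\gamma R_\infty^2]$, for $\gamma\in\mathrm{GL}_2(R_\infty[\nu^{-1}])$, identifies the Bruhat-Tits tree of $\mathrm{PGL}_2(K_\nu)$ with $T_\nu(x_0)$, hence identifies the set of ends of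 $T_\nu(x_0)$ with $\mathbb P^1(K_\nu)$. An end $\xi$ is rational if it belongs to $\mathbb P^1(K)$, which does not depend on $g$. Let $(x_n^\xi)_{n\in\mathbb N}$ be the vertices of the geodesic ray of $T_\nu(x_0)$ from $x_0$ to $\xi$. If $x_0$ is $A_\infty$-periodic then so is every vertex of $T_\nu(x_0)$. Let $\Theta_\xi$ be the set of weak-star accumulation points, as finite measures on $X_\infty$ tested against continuous functions with compact support, of $(\mu_{x_n^\xi})_{n\in\mathbb N}$. **Theorem.** There exist a prime $p$, a prime polynomial $\nu\in\mathbb F_p[Y]$ and an $A_\infty$-periodic point $x_0\in X_\infty$ such that, for every rational end $\xi$ of $T_\nu(x_0)$, the zero measure belongs to $\Theta_\xi$. More precisely, let $p$ be any prime such that $-1$ is not a square modulo $p$, and let $\gamma_0=\begin{pmatrix}Y&1\\1&0\end{pmatrix}$. Then its discriminant $Y^2+4$ is irreducible in $\mathbb F_p[Y]$, there exists $g\in\mathrm{GL}_2(K_\infty)$ such that $g\gamma_0g^{-1}$ is diagonal and, for $\nu=Y^2+4$, for every such $g$ and for $x_0=[gR_\infty^2]$, the point $x_0$ and all vertices of $T_\nu(x_0)$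 are $A_\infty$-periodic and, for every rational end $\xi$ of $T_\nu(x_0)$, the zero measure belongs to $\Theta_\xi$; indeed $\mu_{x_{n_k}^\xi}$ converges weak-star to the zero measure as $k\to\infty$ along $n_k=(p^k-1)/2$. -/

import Mathlib

open Polynomial IsDedekindDomain MeasureTheory Filter Topology
open scoped MatrixGroups CompactlySupported LinearAlgebra.Projectivization

noncomputable section

namespace HeckeEscape

/-- The sublattice of `L²` spanned over `R` by the columns of `g`, that is, `g · R²`. -/
def lattice (R : Type*) {L : Type*} [CommRing R] [Field L] [Algebra R L] (g : GL (Fin 2) L) :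
    Submodule R (Fin 2 → L) :=
  Submodule.span R (Set.range fun j : Fin 2 => fun i : Fin 2 => (g : Matrix (Fin 2) (Fin 2) L) i j)

section Infinity

variable (F : Type*) [Field F]

open scoped Classical in
/-- The field `K_∞ = F((Y⁻¹))`, the completion of `K = F(Y)` at infinity. -/
abbrev KInf : Type _ := RatFunc.CompletionAtInfty F

instance : Algebra F[X] (KInf F) :=
  ((algebraMap (RatFunc F) (KInf F)).comp (algebraMap F[X] (RatFunc F))).toAlgebra

/-- The group `G_∞ = PGL₂(K_∞)`. -/
abbrev GInf : Type _ := PGL(2, KInf F)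

/-- `PGL₂(K_∞)` carries the quotient topology of `GL₂(K_∞)`. -/
instance : TopologicalSpace (GInf F) :=
  inferInstanceAs (TopologicalSpace (GL (Fin 2) (KInf F) ⧸ Subgroup.center (GL (Fin 2) (KInf F))))

/-- The lattice `Γ_∞ = PGL₂(F[Y])` in `G_∞`. -/
def GammaInf : Subgroup (GInf F) :=
  (Matrix.ProjGenLinGroup.map (n := Fin 2) (algebraMap F[X] (KInf F))).range

/-- The space `X_∞ = PGL₂(K_∞) / PGL₂(F[Y])` of homothety classes of `F[Y]`-lattices in `K_∞²`,
with the quotient topology. -/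
abbrev XInf : Type _ := GInf F ⧸ GammaInf F

instance : MeasurableSpace (XInf F) := borel (XInf F)

instance : BorelSpace (XInf F) := ⟨rfl⟩

/-- The diagonal subgroup `A_∞` of `G_∞`. -/
def diagSubgroup : Subgroup (GInf F) :=
  ((Matrix.ProjGenLinGroup.mk (n := Fin 2) (R := KInf F)).comp
    (Units.map (Matrix.diagonalRingHom (Fin 2) (KInf F)).toMonoidHom)).range

end Infinity

variable {F : Type*} [Field F]

/-- The homothety class in `X_∞` of the lattice `g · F[Y]²`. -/
def pt (g : GL (Fin 2) (KInf F)) : XInf F :=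
  QuotientGroup.mk (Matrix.ProjGenLinGroup.mk g)

/-- `x` is `A_∞`-periodic: its `A_∞`-orbit is compact. -/
def IsPeriodic (x : XInf F) : Prop :=
  IsCompact (MulAction.orbit (diagSubgroup F) x)

/-- `μ` is an `A_∞`-invariant probability measure carried by the orbit `A_∞ x`. -/
structure IsOrbitMeasure (x : XInf F) (μ : Measure (XInf F)) : Prop where
  isProbabilityMeasure : IsProbabilityMeasure μ
  invariant : SMulInvariantMeasure (diagSubgroup F) (XInf F) μ
  carried : μ (MulAction.orbit (diagSubgroup F) x)ᶜ = 0

open scoped Classical in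
/-- The measure `μ_x`: the invariant probability measure on the orbit `A_∞ x`
(and `0` by convention if there is none, which does not happen when `x` is periodic). -/
def orbitMeasure (x : XInf F) : Measure (XInf F) :=
  if h : ∃ μ, IsOrbitMeasure x μ then h.choose else 0

/-- The set `Θ` of finite measures on `X_∞` that are weak-star accumulation points (that is,
against continuous functions with compact support) of the sequence of measures `μ_{x n}`. -/
def accPoints (x : ℕ → XInf F) : Set (Measure (XInf F)) :=
  {θ | IsFiniteMeasure θ ∧
    MapClusterPt (fun f : C_c(XInf F, ℝ) => ∫ y, f y ∂θ) atTop
      (fun (n : ℕ) (f : C_c(XInf F, ℝ)) => ∫ y, f y ∂(orbitMeasure (x n)))}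

section Hecke

/-- `x = [Λ]` and `y = [Λ']` for some lattices `Λ' ⊆ Λ` with `Λ / Λ'` isomorphic to
`F[Y] / ν F[Y]`. -/
def HeckeRel (ν : HeightOneSpectrum F[X]) (x y : XInf F) : Prop :=
  ∃ g h : GL (Fin 2) (KInf F), pt g = x ∧ pt h = y ∧ lattice F[X] h ≤ lattice F[X] g ∧
    Nonempty ((lattice F[X] g ⧸ (lattice F[X] h).submoduleOf (lattice F[X] g)) ≃ₗ[F[X]]
      (F[X] ⧸ ν.asIdeal))

/-- The graph on `X_∞` whose connected components are the `ν`-Hecke trees. -/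
def heckeGraph (ν : HeightOneSpectrum F[X]) : SimpleGraph (XInf F) :=
  SimpleGraph.fromRel (HeckeRel ν)

/-- `x` is (the sequence of vertices of) a geodesic ray of the Hecke tree, starting at `x₀`.
Since the component of `x₀` is a tree, its ends correspond to these rays. -/
def IsHeckeRay (ν : HeightOneSpectrum F[X]) (x₀ : XInf F) (x : ℕ → XInf F) : Prop :=
  x 0 = x₀ ∧ ∀ m k : ℕ, (heckeGraph ν).dist (x m) (x (m + k)) = k

/-- The completion `K_ν`. -/
abbrev KNu (ν : HeightOneSpectrum F[X]) : Type _ := ν.adicCompletion (RatFunc F)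

/-- The local ring `O_ν` of `K_ν`. -/
abbrev ONu (ν : HeightOneSpectrum F[X]) : Type _ := ν.adicCompletionIntegers (RatFunc F)

/-- The ring `F[Y][1/ν]`, as the ring of `{ν}`-integers of `K`. -/
abbrev SInt (ν : HeightOneSpectrum F[X]) : Subalgebra F[X] (RatFunc F) :=
  ({ν} : Set (HeightOneSpectrum F[X])).integer (RatFunc F)

/-- The map `GL₂(F[Y][1/ν]) → GL₂(K_∞)`. -/
def toInf (ν : HeightOneSpectrum F[X]) : GL (Fin 2) (SInt ν) →* GL (Fin 2) (KInf F) :=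
  Matrix.GeneralLinearGroup.map
    ((algebraMap (RatFunc F) (KInf F)).comp (algebraMap (SInt ν) (RatFunc F)))

/-- The map `GL₂(F[Y][1/ν]) → GL₂(K_ν)`. -/
def toNu (ν : HeightOneSpectrum F[X]) : GL (Fin 2) (SInt ν) →* GL (Fin 2) (KNu ν) :=
  Matrix.GeneralLinearGroup.map
    ((algebraMap (RatFunc F) (KNu ν)).comp (algebraMap (SInt ν) (RatFunc F)))

/-- The graph of the identification of the Bruhat-Tits tree of `PGL₂(K_ν)` with the Hecke tree of
`[g F[Y]²]` attached to `g`: the vertex `[γ O_ν²]` is sent to `[g γ F[Y]²]`, for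
`γ ∈ GL₂(F[Y][1/ν])`. Every `O_ν`-lattice of `K_ν²` is of the form `γ O_ν²` for such a `γ`, which
is unique up to `GL₂(F[Y])` on the right. -/
def HecMap (ν : HeightOneSpectrum F[X]) (g : GL (Fin 2) (KInf F))
    (M : Submodule (ONu ν) (Fin 2 → KNu ν)) (x : XInf F) : Prop :=
  ∃ γ : GL (Fin 2) (SInt ν), lattice (ONu ν) (toNu ν γ) = M ∧ pt (g * toInf ν γ) = x

/-- Through the identification attached to `g`, the ray `x` converges to the point `ξ` of
`P¹(K_ν)`, the boundary of the Bruhat-Tits tree: its vertices are represented by a non-increasing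
sequence of `O_ν`-lattices whose intersection spans the line `ξ`. -/
def HasEnd (ν : HeightOneSpectrum F[X]) (g : GL (Fin 2) (KInf F)) (x : ℕ → XInf F)
    (ξ : ℙ (KNu ν) (Fin 2 → KNu ν)) : Prop :=
  ∃ M : ℕ → Submodule (ONu ν) (Fin 2 → KNu ν), Antitone M ∧ (∀ n, HecMap ν g (M n) (x n)) ∧
    Submodule.span (KNu ν) ((⨅ n, M n : Submodule (ONu ν) (Fin 2 → KNu ν)) : Set (Fin 2 → KNu ν))
      = ξ.submodule

/-- The inclusion `P¹(K) → P¹(K_ν)`. -/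
def ratPoint (ν : HeightOneSpectrum F[X]) :
    ℙ (RatFunc F) (Fin 2 → RatFunc F) → ℙ (KNu ν) (Fin 2 → KNu ν) :=
  Projectivization.map (σ := algebraMap (RatFunc F) (KNu ν))
    { toFun := fun v i => algebraMap (RatFunc F) (KNu ν) (v i)
      map_add' := fun v w => by ext i; simp
      map_smul' := fun c v => by ext i; simp }
    (fun v w h => funext fun i =>
      (algebraMap (RatFunc F) (KNu ν)).injective (congrFun h i))

/-- The end of the Hecke ray `x` is rational: it corresponds to a point of `P¹(K)` through the
identification attached to a representative `g` of the origin (the choice does not matter). -/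
def IsRationalRay (ν : HeightOneSpectrum F[X]) (x : ℕ → XInf F) : Prop :=
  ∃ g : GL (Fin 2) (KInf F), pt g = x 0 ∧
    ∃ ξ : ℙ (RatFunc F) (Fin 2 → RatFunc F), HasEnd ν g x (ratPoint ν ξ)

end Hecke

/-- The matrix `γ₀` with rows `(Y, 1)` and `(1, 0)`, in `GL₂(F[Y])`. -/
def gamma0 (F : Type*) [Field F] : GL (Fin 2) F[X] where
  val := !![X, 1; 1, 0]
  inv := !![0, 1; 1, -X]
  val_inv := by simp [Matrix.one_fin_two]
  inv_val := by simp [Matrix.one_fin_two]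

/-- The image of `γ₀` in `GL₂(K_∞)`. -/
def gamma0Inf (F : Type*) [Field F] : GL (Fin 2) (KInf F) :=
  Matrix.GeneralLinearGroup.map (algebraMap F[X] (KInf F)) (gamma0 F)

end HeckeEscape

end

/-! Put `N = 2γ₀ - Y`, so that `N² = Y² + 4 = ν`. Since `Y` and `N` commute, the Frobenius gives
`(2γ₀)^(p^k) = Y^(p^k) + ν^n N` with `n = (p^k - 1)/2` (`gamma0_pow`). Thus `γ₀^(p^k)` is scalar
modulo `ν^n` and fixes every vertex of the Hecke tree at distance at most `n` from `x₀`
(`exists_gamma0_pow_mul`, `torus_pow_smul_pt`). In the eigenbasis, `γ₀` acts as `diag(u, 1)` with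
`log |u| = ±2` (`vInf_eigenvalues`). Hence the orbit of `x_n` has a period of logarithmic length
only `2 p^k`, whereas `n` is of size `p^k / 2`.

Along a ray with a rational end, the lattices can be chosen to share a nonzero vector `w`, while the
log of their covolume at infinity is at least `2n = p^k - 1` up to an additive constant
(`exists_lattices_of_ray`). After normalization `w` is extremely short, and applying `diag(u, 1)`
can only lengthen it enough when `|log |u||` is at least `p^k - O(1)` (`le_abs_of_isThick`). A full
period of length `2 p^k` can be centred at `0`, so it meets a given thick part only within `O(1)` of
its two extremities (`card_filter_range_le`). The thick part therefore has measure `O(p^(-k))` for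
`μ_{x_n}` (`exists_bound_thickPart`). Every compact set lies in a thick part
(`exists_subset_thickPart`), so all the mass escapes.

The remaining work is foundational: the topology of `K_∞` and of `X_∞`, existence and uniqueness of
the orbit measures, and the passage between the combinatorial Hecke graph and integral matrices. -/

noncomputable section
namespace HeckeEscape
open scoped WithZero

/-! ### The local field `F((Y⁻¹))`: valuation, polynomial parts, compactness. -/

section CompletionAtInfinity

variable {F : Type*} [Field F]

/-- The valuation of `K_∞`, with values in `ℤᵐ⁰`. -/
def vInf : Valuation (KInf F) ℤᵐ⁰ := Valued.v

instance : CompleteSpace (KInf F) :=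
  inferInstanceAs (CompleteSpace (@UniformSpace.Completion (RatFunc F)
    (@RatFunc.inftyValued F _ (Classical.decEq _)).toUniformSpace))

instance : IsScalarTower F[X] (RatFunc F) (KInf F) := IsScalarTower.of_algebraMap_eq fun _ => rfl

open scoped Classical in
theorem vInf_algebraMap_ratFunc (r : RatFunc F) :
    vInf (algebraMap (RatFunc F) (KInf F) r) = RatFunc.inftyValuation F r :=
  @Valued.valuedCompletion_apply (RatFunc F) _ _ _ (RatFunc.inftyValued F) r

theorem vInf_algebraMap {P : F[X]} (hP : P ≠ 0) :
    vInf (algebraMap F[X] (KInf F) P) = WithZero.exp (P.natDegree : ℤ) := by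
  classical
  rw [IsScalarTower.algebraMap_apply F[X] (RatFunc F) (KInf F), vInf_algebraMap_ratFunc]
  exact RatFunc.inftyValuation.polynomial F hP

theorem algebraMap_inf_injective : Function.Injective (algebraMap F[X] (KInf F)) := by
  rw [IsScalarTower.algebraMap_eq F[X] (RatFunc F) (KInf F)]
  exact (algebraMap (RatFunc F) (KInf F)).injective.comp (RatFunc.algebraMap_injective F)

theorem algebraMap_inf_X_ne_zero : algebraMap F[X] (KInf F) X ≠ 0 := by
  simpa using (map_ne_zero_iff _ algebraMap_inf_injective).2 (X_ne_zero (R := F))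

theorem one_le_vInf_algebraMap {P : F[X]} (hP : P ≠ 0) :
    1 ≤ vInf (algebraMap F[X] (KInf F) P) := by
  rw [vInf_algebraMap hP, ← WithZero.exp_zero, WithZero.exp_le_exp]
  positivity

theorem vInf_X : vInf (algebraMap F[X] (KInf F) X) = WithZero.exp (1 : ℤ) := by
  rw [vInf_algebraMap X_ne_zero, natDegree_X, Nat.cast_one]

theorem vInf_X_zpow (n : ℤ) :
    vInf ((algebraMap F[X] (KInf F) X) ^ n) = WithZero.exp n := by
  rw [map_zpow₀, vInf_X, ← WithZero.exp_zsmul, smul_eq_mul, mul_one]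

theorem exists_vInf_eq (x : KInf F) (hx : x ≠ 0) : ∃ n : ℤ, vInf x = WithZero.exp n :=
  ⟨WithZero.log (vInf x), (WithZero.exp_log ((Valuation.ne_zero_iff _).2 hx)).symm⟩

theorem hasBasis_nhds_zero_vInf :
    (𝓝 (0 : KInf F)).HasBasis (fun _ : ℤ => True) fun n => {x | vInf x < WithZero.exp n} := by
  refine ⟨fun s => Valued.mem_nhds_zero.trans ⟨?_, ?_⟩⟩
  · rintro ⟨γ, hγ⟩
    have h0 : MonoidWithZeroHom.ValueGroup₀.embedding γ.1 ≠ (0 : ℤᵐ⁰) := by simp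
    refine ⟨WithZero.log (MonoidWithZeroHom.ValueGroup₀.embedding γ.1), trivial, ?_⟩
    intro x hx
    apply hγ
    rw [Set.mem_ofPred_eq, Valuation.restrict_lt_iff_lt_embedding]
    rw [Set.mem_ofPred_eq, WithZero.exp_log h0] at hx
    exact hx
  · rintro ⟨n, -, hn⟩
    have h0 : Valued.v.restrict ((algebraMap F[X] (KInf F) X) ^ n) ≠ 0 :=
      (Valuation.ne_zero_iff _).2 (zpow_ne_zero n (algebraMap_inf_X_ne_zero (F := F)))
    refine ⟨Units.mk0 _ h0, ?_⟩
    intro x hx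
    apply hn
    rw [Set.mem_ofPred_eq, Units.val_mk0, Valuation.restrict_lt_iff] at hx
    rw [Set.mem_ofPred_eq, ← vInf_X_zpow (F := F) n]
    exact hx

theorem eventually_vInf_eq {x : KInf F} (hx : x ≠ 0) :
    ∀ᶠ y in 𝓝 x, vInf y = vInf x :=
  Valued.locally_const ((Valuation.ne_zero_iff _).2 hx)

theorem eventually_vInf_sub_lt (x : KInf F) (n : ℤ) :
    ∀ᶠ y in 𝓝 x, vInf (y - x) < WithZero.exp n := by
  have h : Tendsto (fun y : KInf F => y - x) (𝓝 x) (𝓝 0) := by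
    have : Continuous (fun y : KInf F => y - x) := by fun_prop
    simpa using this.tendsto x
  exact h.eventually (hasBasis_nhds_zero_vInf.mem_of_mem trivial)

theorem isClosed_setOf_vInf_le (n : ℤ) : IsClosed {x : KInf F | vInf x ≤ WithZero.exp n} := by
  rw [← isOpen_compl_iff, isOpen_iff_mem_nhds]
  intro x hx
  have hx' : ¬ vInf x ≤ WithZero.exp n := hx
  have h0 : x ≠ 0 := by rintro rfl; simp at hx'
  filter_upwards [eventually_vInf_eq h0] with y hy
  simpa [hy] using hx'

theorem denseRange_algebraMap_inf : DenseRange (algebraMap (RatFunc F) (KInf F)) :=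
  @UniformSpace.Completion.denseRange_coe (RatFunc F)
    (@RatFunc.inftyValued F _ (Classical.decEq _)).toUniformSpace

theorem exists_ratFunc_near (x : KInf F) (n : ℤ) :
    ∃ r : RatFunc F, vInf (algebraMap (RatFunc F) (KInf F) r - x) < WithZero.exp n := by
  obtain ⟨y, hy, r, rfl⟩ := mem_closure_iff_nhds.1 (denseRange_algebraMap_inf x) _
    (eventually_vInf_sub_lt x n)
  exact ⟨r, hy⟩

/-- This is the polynomial part of a Laurent series: `K` is dense, and Euclidean division splits a
fraction into a polynomial and a proper fraction, whose valuation is less than `1`. -/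
theorem exists_polynomial_near (x : KInf F) :
    ∃ P : F[X], vInf (x - algebraMap F[X] (KInf F) P) < 1 := by
  obtain ⟨r, hr⟩ := exists_ratFunc_near x 0
  obtain ⟨a, b, hb, rfl⟩ := IsFractionRing.div_surjective (A := F[X]) r
  have hb0 : b ≠ 0 := nonZeroDivisors.ne_zero hb
  have hb' : algebraMap F[X] (KInf F) b ≠ 0 := by
    simpa using (map_ne_zero_iff _ algebraMap_inf_injective).2 hb0
  refine ⟨a / b, ?_⟩
  have e : x - algebraMap F[X] (KInf F) (a / b) =
      -(algebraMap (RatFunc F) (KInf F) (algebraMap F[X] (RatFunc F) a / algebraMap F[X] (RatFunc F) b) - x)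
        + algebraMap F[X] (KInf F) (a % b) / algebraMap F[X] (KInf F) b := by
    rw [map_div₀, ← IsScalarTower.algebraMap_apply, ← IsScalarTower.algebraMap_apply]
    have := congrArg (algebraMap F[X] (KInf F)) (EuclideanDomain.div_add_mod a b)
    rw [map_add, map_mul] at this
    field_simp
    linear_combination -this
  rw [e]
  refine (vInf.map_add _ _).trans_lt (max_lt ?_ ?_)
  · rw [Valuation.map_neg]
    simpa using hr
  · rw [map_div₀]
    by_cases h0 : a % b = 0
    · simp [h0]
    · rw [vInf_algebraMap h0, vInf_algebraMap hb0, ← WithZero.exp_sub, ← WithZero.exp_zero,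
        WithZero.exp_lt_exp]
      have := Polynomial.natDegree_lt_natDegree h0 (EuclideanDomain.mod_lt a hb0)
      omega

/-- The unit ball is complete, being closed. For total boundedness, taking the polynomial part of `x
Y^n` approximates `x` by some `P / Y^n` with `deg P ≤ n`, and there are finitely many such `P`
because `F` is finite. -/
theorem isCompact_setOf_vInf_le_one [Finite F] : IsCompact {x : KInf F | vInf x ≤ 1} := by
  have hc := isClosed_setOf_vInf_le (F := F) 0
  rw [WithZero.exp_zero] at hc
  rw [isCompact_iff_totallyBounded_isComplete]
  refine ⟨?_, hc.isComplete⟩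
  rw [totallyBounded_iff_subset_finite_iUnion_nhds_zero]
  intro U hU
  obtain ⟨m, -, hm⟩ := hasBasis_nhds_zero_vInf.mem_iff.1 hU
  obtain ⟨n, hn⟩ : ∃ n : ℕ, -m ≤ n := ⟨(-m).toNat, Int.self_le_toNat _⟩
  set T : KInf F := algebraMap F[X] (KInf F) X
  have hT : T ≠ 0 := algebraMap_inf_X_ne_zero
  have hT1 : vInf T = WithZero.exp (1 : ℤ) := vInf_X
  have hfin : (Set.image (fun P : F[X] => algebraMap F[X] (KInf F) P / T ^ n)
      (degreeLT F (n + 1) : Set F[X])).Finite := by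
    apply Set.Finite.image
    have : Finite (degreeLT F (n + 1)) := Finite.of_equiv _ (degreeLTEquiv F (n + 1)).symm.toEquiv
    exact Set.toFinite _
  refine ⟨_, hfin, ?_⟩
  intro x hx
  obtain ⟨P, hP⟩ := exists_polynomial_near (x * T ^ n)
  have hPd : P ∈ degreeLT F (n + 1) := by
    rw [mem_degreeLT]
    by_cases h0 : P = 0
    · simp [h0]
    rw [degree_eq_natDegree h0]
    have h1 : vInf (algebraMap F[X] (KInf F) P) ≤ WithZero.exp (n : ℤ) := by
      have e : algebraMap F[X] (KInf F) P =
        x * T ^ n - (x * T ^ n - algebraMap F[X] (KInf F) P) := by ring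
      rw [e]
      refine (vInf.map_sub _ _).trans (max_le ?_ (hP.le.trans ?_))
      · rw [map_mul, map_pow, hT1, ← WithZero.exp_nsmul]
        simpa using mul_le_mul_left hx (WithZero.exp (n : ℤ))
      · rw [← WithZero.exp_zero, WithZero.exp_le_exp]; positivity
    rw [vInf_algebraMap h0, WithZero.exp_le_exp] at h1
    exact_mod_cast Nat.lt_succ_of_le (by exact_mod_cast h1)
  simp only [Set.mem_iUnion]
  refine ⟨_, ⟨P, hPd, rfl⟩, ?_⟩
  rw [Set.mem_vadd_set_iff_neg_vadd_mem]
  apply hm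
  have e : -(algebraMap F[X] (KInf F) P / T ^ n) +ᵥ x =
      (x * T ^ n - algebraMap F[X] (KInf F) P) / T ^ n := by
    rw [vadd_eq_add]; field_simp; ring
  rw [Set.mem_ofPred_eq, e, map_div₀, map_pow, hT1, ← WithZero.exp_nsmul]
  rw [div_lt_iff₀ (by simp), ← WithZero.exp_add]
  refine hP.trans_le ?_
  rw [← WithZero.exp_zero, WithZero.exp_le_exp, nsmul_eq_mul]
  linarith

theorem isCompact_setOf_vInf_le [Finite F] (n : ℤ) :
    IsCompact {x : KInf F | vInf x ≤ WithZero.exp n} := by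
  have hT : algebraMap F[X] (KInf F) X ≠ 0 := algebraMap_inf_X_ne_zero
  have h := (isCompact_setOf_vInf_le_one (F := F)).image
    (f := fun x => x * (algebraMap F[X] (KInf F) X) ^ n) (by fun_prop)
  refine h.of_isClosed_subset (isClosed_setOf_vInf_le n) ?_
  intro x hx
  refine ⟨x * (algebraMap F[X] (KInf F) X) ^ (-n), ?_, ?_⟩
  · rw [Set.mem_ofPred_eq, map_mul, vInf_X_zpow]
    calc _ ≤ WithZero.exp n * WithZero.exp (-n) := mul_le_mul_left hx _
      _ = 1 := by rw [← WithZero.exp_add]; simp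
  · simp only
    rw [mul_assoc, ← zpow_add₀ hT]
    simp

instance [Finite F] : LocallyCompactSpace (KInf F) := by
  refine (isCompact_setOf_vInf_le_one (F := F)).locallyCompactSpace_of_mem_nhds_of_addGroup (x := 0) ?_
  have := (hasBasis_nhds_zero_vInf (F := F)).mem_of_mem (i := 0) trivial
  filter_upwards [this] with x hx
  simpa using hx.le

/-- Second countability makes the action map measurable for the product σ-algebra in the Fubini
argument of `eq_map_of_invariant`. -/
instance [Countable F] : SecondCountableTopology (KInf F) := by
  have : Function.Surjective fun x : F[X] × F[X] =>
      algebraMap F[X] (RatFunc F) x.1 / algebraMap F[X] (RatFunc F) x.2 := by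
    intro z
    obtain ⟨a, b, -, rfl⟩ := IsFractionRing.div_surjective (A := F[X]) z
    exact ⟨(a, b), rfl⟩
  have : Countable F[X] := by
    have : Function.Injective fun P : F[X] => P.toFinsupp.coeff := fun P Q h =>
      Polynomial.ext fun n => DFunLike.congr_fun h n
    exact this.countable
  have : Countable (RatFunc F) := ‹Function.Surjective _›.countable
  have : TopologicalSpace.SeparableSpace (KInf F) :=
    ⟨_, Set.countable_range _, denseRange_algebraMap_inf⟩
  have : (𝓝 (0 : KInf F)).IsCountablyGenerated := by
    exact (HasCountableBasis.mk (hasBasis_nhds_zero_vInf) (Set.to_countable _)).isCountablyGenerated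
  have : (uniformity (KInf F)).IsCountablyGenerated := IsUniformAddGroup.uniformity_countably_generated
  exact UniformSpace.secondCountable_of_separable _

end CompletionAtInfinity

/-! ### Discreteness of `PGL₂(F[Y])` and separation of `X_∞`. -/

section Topology

variable {F : Type*} [Field F]

instance : IsTopologicalGroup (GInf F) :=
  inferInstanceAs
    (IsTopologicalGroup (GL (Fin 2) (KInf F) ⧸ Subgroup.center (GL (Fin 2) (KInf F))))

theorem isOpenQuotientMap_mk :
    IsOpenQuotientMap (Matrix.ProjGenLinGroup.mk : GL (Fin 2) (KInf F) → GInf F) :=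
  QuotientGroup.isOpenQuotientMap_mk (N := Subgroup.center (GL (Fin 2) (KInf F)))

theorem isOpenQuotientMap_pt : IsOpenQuotientMap (pt : GL (Fin 2) (KInf F) → XInf F) :=
  (QuotientGroup.isOpenQuotientMap_mk (N := GammaInf F)).comp isOpenQuotientMap_mk

theorem isClosed_center_of_t2Space {G : Type*} [Group G] [TopologicalSpace G] [ContinuousMul G]
    [T2Space G] : IsClosed (Subgroup.center G : Set G) := by
  have : (Subgroup.center G : Set G) = ⋂ g : G, {z | g * z = z * g} := by
    ext z
    simp [Subgroup.mem_center_iff]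
  rw [this]
  exact isClosed_iInter fun g => isClosed_eq (by fun_prop) (by fun_prop)

instance : T2Space (GInf F) := by
  have : IsClosed (Subgroup.center (GL (Fin 2) (KInf F)) : Set (GL (Fin 2) (KInf F))) :=
    isClosed_center_of_t2Space
  exact inferInstanceAs
    (T2Space (GL (Fin 2) (KInf F) ⧸ Subgroup.center (GL (Fin 2) (KInf F))))

theorem eq_zero_of_vInf_lt_one {P : F[X]} (h : vInf (algebraMap F[X] (KInf F) P) < 1) : P = 0 := by
  by_contra h0
  exact absurd (one_le_vInf_algebraMap h0) (not_le.2 h)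

theorem continuous_apply_GL (i j : Fin 2) :
    Continuous fun g : GL (Fin 2) (KInf F) => (g : Matrix (Fin 2) (Fin 2) (KInf F)) i j :=
  (Units.continuous_val).matrix_elem i j

theorem mem_GammaInf_mk {g : GL (Fin 2) (KInf F)} :
    Matrix.ProjGenLinGroup.mk g ∈ GammaInf F ↔ ∃ (c : (KInf F)ˣ) (U : GL (Fin 2) F[X]),
      g = Matrix.GeneralLinearGroup.map (algebraMap F[X] (KInf F)) U *
        Matrix.GeneralLinearGroup.scalar (Fin 2) c := by
  constructor
  · rintro ⟨y, hy⟩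
    induction y using Matrix.ProjGenLinGroup.induction_on with | mk U =>
    rw [Matrix.ProjGenLinGroup.map_mk, Matrix.ProjGenLinGroup.mk_eq_mk_iff] at hy
    obtain ⟨c, hc⟩ := hy
    exact ⟨c, U, hc.symm⟩
  · rintro ⟨c, U, rfl⟩
    exact ⟨Matrix.ProjGenLinGroup.mk U, by simp⟩

theorem vInf_det_map (U : GL (Fin 2) F[X]) :
    vInf (algebraMap F[X] (KInf F) (U : Matrix (Fin 2) (Fin 2) F[X]).det) = 1 := by
  have h : IsUnit (U : Matrix (Fin 2) (Fin 2) F[X]).det := U.isUnit.map Matrix.detMonoidHom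
  rw [vInf_algebraMap h.ne_zero, natDegree_eq_zero_of_isUnit h]
  simp

theorem scalar_mem_range {U : GL (Fin 2) F[X]}
    (h01 : (U : Matrix (Fin 2) (Fin 2) F[X]) 0 1 = 0)
    (h10 : (U : Matrix (Fin 2) (Fin 2) F[X]) 1 0 = 0)
    (h : (U : Matrix (Fin 2) (Fin 2) F[X]) 0 0 = (U : Matrix (Fin 2) (Fin 2) F[X]) 1 1) :
    Matrix.ProjGenLinGroup.mk U = 1 := by
  rw [Matrix.ProjGenLinGroup.mk_eq_one, Subgroup.mem_center_iff]
  intro g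
  ext i j
  fin_cases i <;> fin_cases j <;> simp [Matrix.mul_apply, Fin.sum_univ_two, h01, h10, h, mul_comm]

theorem eventually_near_one : ∀ᶠ g : GL (Fin 2) (KInf F) in 𝓝 1, (∀ i j,
    vInf ((g : Matrix (Fin 2) (Fin 2) (KInf F)) i j -
      (1 : Matrix (Fin 2) (Fin 2) (KInf F)) i j) < 1) ∧
    vInf (g : Matrix (Fin 2) (Fin 2) (KInf F)).det = 1 := by
  refine Eventually.and (eventually_all.2 fun i => eventually_all.2 fun j => ?_) ?_
  · have := (continuous_apply_GL (F := F) i j).tendsto 1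
    simpa using this.eventually (eventually_vInf_sub_lt _ 0)
  · have hc : Continuous fun g : GL (Fin 2) (KInf F) =>
      (g : Matrix (Fin 2) (Fin 2) (KInf F)).det := Units.continuous_val.matrix_det
    have := (hc.tendsto 1).eventually (eventually_vInf_eq (by simp))
    simpa using this

/-- A polynomial of valuation less than `1` vanishes. For `U c` close to the identity, the
determinant forces `|c| = 1`; then the off-diagonal entries of `U` and the difference of its
diagonal entries are polynomials of valuation less than `1`, so `U` is scalar. -/
theorem eventually_eq_one_of_mem_GammaInf : ∀ᶠ x in 𝓝 (1 : GInf F), x ∈ GammaInf F → x = 1 := by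
  rw [← map_one (Matrix.ProjGenLinGroup.mk : GL (Fin 2) (KInf F) →* GInf F),
    ← isOpenQuotientMap_mk.isOpenMap.map_nhds_eq isOpenQuotientMap_mk.continuous.continuousAt,
    eventually_map]
  filter_upwards [eventually_near_one] with g ⟨hg, hgd⟩ hmem
  obtain ⟨c, U, rfl⟩ := mem_GammaInf_mk.1 hmem
  set M : Matrix (Fin 2) (Fin 2) F[X] := U.val with hM
  have hent : ∀ i j, ((Matrix.GeneralLinearGroup.map (algebraMap F[X] (KInf F)) U *
        Matrix.GeneralLinearGroup.scalar (Fin 2) c : GL (Fin 2) (KInf F)) :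
          Matrix (Fin 2) (Fin 2) (KInf F)) i j = algebraMap F[X] (KInf F) (M i j) * c := by
    intro i j
    simp [hM]
  -- `det U` is a nonzero constant, so the determinant of `U c` has the valuation of `c²`.
  have hc : vInf (c : KInf F) = 1 := by
    rw [Matrix.det_fin_two] at hgd
    simp only [hent] at hgd
    have e : algebraMap F[X] (KInf F) (M 0 0) * c * (algebraMap F[X] (KInf F) (M 1 1) * c) -
      algebraMap F[X] (KInf F) (M 0 1) * c * (algebraMap F[X] (KInf F) (M 1 0) * c) =
        algebraMap F[X] (KInf F) M.det * c ^ 2 := by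
      rw [Matrix.det_fin_two, map_sub, map_mul, map_mul]; ring
    rw [e, map_mul, vInf_det_map, one_mul, map_pow] at hgd
    exact (pow_eq_one_iff.1 hgd).resolve_right two_ne_zero
  have hoff : ∀ i j, i ≠ j → M i j = 0 := by
    intro i j hij
    have := hg i j
    rw [hent, Matrix.one_apply_ne hij, sub_zero, map_mul, hc, mul_one] at this
    exact eq_zero_of_vInf_lt_one this
  have hdiag : M 0 0 = M 1 1 := by
    rw [← sub_eq_zero]
    apply eq_zero_of_vInf_lt_one
    have h0 := hg 0 0
    have h1 := hg 1 1
    rw [hent, Matrix.one_apply_eq] at h0 h1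
    have := (vInf.map_sub _ _).trans_lt (max_lt h0 h1)
    have e : algebraMap F[X] (KInf F) (M 0 0) * c - 1 - (algebraMap F[X] (KInf F) (M 1 1) * c - 1) =
      algebraMap F[X] (KInf F) (M 0 0 - M 1 1) * c := by rw [map_sub]; ring
    rwa [e, map_mul, hc, mul_one] at this
  rw [map_mul, Matrix.ProjGenLinGroup.mk_scalar, mul_one, ← Matrix.ProjGenLinGroup.map_mk,
    scalar_mem_range (hoff 0 1 (by decide)) (hoff 1 0 (by decide)) hdiag, map_one, map_one]

instance : DiscreteTopology (GammaInf F) := by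
  refine discreteTopology_of_isOpen_singleton_one ?_
  refine isOpen_singleton_iff_nhds_eq_pure _ |>.2 (le_antisymm ?_ (pure_le_nhds _))
  rw [nhds_subtype_eq_comap, le_pure_iff, mem_comap]
  exact ⟨_, eventually_eq_one_of_mem_GammaInf, fun x hx => Subtype.ext (hx x.2)⟩

instance : IsClosed (GammaInf F : Set (GInf F)) := Subgroup.isClosed_of_discrete

/-- Separation makes compact orbits closed, hence Borel. -/
instance : T2Space (XInf F) := by
  rw [t2Space_iff_of_isOpenQuotientMap (QuotientGroup.isOpenQuotientMap_mk (N := GammaInf F))]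
  have : {q : GInf F × GInf F | (q.1 : XInf F) = q.2} =
      (fun q : GInf F × GInf F => q.1⁻¹ * q.2) ⁻¹' (GammaInf F) := by
    ext q
    exact QuotientGroup.eq
  rw [this]
  exact IsClosed.preimage (by fun_prop) inferInstance

end Topology

/-! ### Invariant probability measures on orbits of abelian groups. -/

section InvariantMeasure

variable {H G Z : Type*} [CommGroup H] [TopologicalSpace H]
  [MeasurableSpace H] [BorelSpace H] [Group G] [TopologicalSpace G]
  [TopologicalSpace Z] [MulAction G Z] [ContinuousSMul G Z] [MeasurableSpace Z] [BorelSpace Z]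

-- As `H` is commutative, `h • D` is again a fundamental domain, and an invariant set meets any two
-- fundamental domains in equal measure; left invariance of `η` then moves `h • D` back to `D`.
open scoped Pointwise in
theorem measure_fundamentalDomain_inter_eq [IsTopologicalGroup H] (η : Measure H) [η.IsMulLeftInvariant] (Λ : Subgroup H)
    [Countable Λ] {D : Set H} (hD : IsFundamentalDomain Λ D η) (h : H) {A : Set H}
    (hA : MeasurableSet A) (hinv : ∀ g ∈ Λ, ∀ x, g * x ∈ A ↔ x ∈ A) :
    η ((fun x => h * x) ⁻¹' A ∩ D) = η (A ∩ D) := by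
  have hinv' : ∀ g : Λ, (fun x => g • x) ⁻¹' A = A := fun g => Set.ext fun x => hinv g g.2 x
  have h1 := (hD.smul_of_comm h).measure_set_eq hD hA hinv'
  rw [← h1, ← measure_preimage_mul η h (A ∩ h • D)]
  congr 1
  ext x
  simp [Set.mem_smul_set_iff_inv_smul_mem]

/-- Normalized Haar measure on `D` replaces the Haar measure of `H ⧸ Λ`: it is invariant under `H`
as long as only `Λ`-invariant sets are tested. -/
theorem exists_probability_of_fundamentalDomain [IsTopologicalGroup H] [LocallyCompactSpace H]
    (Λ : Subgroup H) [Countable Λ] {D C : Set H} (hD : IsOpen D) (hne : D.Nonempty)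
    (hC : IsCompact C) (hDC : D ⊆ C) (h : ∀ x, ∃! g : Λ, (g : H) * x ∈ D) :
    ∃ m : Measure H, IsProbabilityMeasure m ∧ ∀ (h : H) (A : Set H), MeasurableSet A →
      (∀ g ∈ Λ, ∀ x, g * x ∈ A ↔ x ∈ A) → m ((fun x => h * x) ⁻¹' A) = m A := by
  let η : Measure H := Measure.haar
  have hDtop : η D ≠ ⊤ := measure_ne_top_of_subset hDC hC.measure_lt_top.ne
  have hD0 : η D ≠ 0 := (hD.measure_pos η hne).ne'
  have hfund : IsFundamentalDomain Λ D η :=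
    IsFundamentalDomain.mk' hD.measurableSet.nullMeasurableSet h
  refine ⟨(η D)⁻¹ • η.restrict D, ⟨by simp [ENNReal.inv_mul_cancel hD0 hDtop]⟩,
    fun h A hA hinv => ?_⟩
  have hA' : MeasurableSet ((fun x => h * x) ⁻¹' A) := (measurable_const_mul h) hA
  rw [Measure.smul_apply, Measure.smul_apply, Measure.restrict_apply hA,
    Measure.restrict_apply hA', measure_fundamentalDomain_inter_eq η Λ hfund h hA hinv]

/-- Uniqueness by Fubini: the `m × μ`-measure of `{(u, z) | d u • z ∈ B}` is `μ B` by invariance of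
`μ`, and it is `m {u | d u • y ∈ B}` by invariance of `m`, since almost every `z` is of the form `d
k • y`. -/
theorem eq_map_of_invariant [SecondCountableTopology H] (d : H →* G)
    (hd : Continuous d) (y : Z) (m : Measure H) [IsProbabilityMeasure m]
    (hm : ∀ (h : H) (B : Set Z), MeasurableSet B →
      m {u | d (h * u) • y ∈ B} = m {u | d u • y ∈ B})
    (μ : Measure Z) [IsProbabilityMeasure μ]
    (hinv : ∀ (h : H) (B : Set Z), MeasurableSet B → μ ((fun z => d h • z) ⁻¹' B) = μ B)
    (hcar : μ (Set.range fun u => d u • y)ᶜ = 0) :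
    μ = m.map (fun u => d u • y) := by
  have hc : Continuous fun q : H × Z => d q.1 • q.2 := by fun_prop
  have hy : Measurable fun u => d u • y := (by fun_prop : Continuous fun u => d u • y).measurable
  ext B hB
  rw [Measure.map_apply hy hB]
  have hmeas : MeasurableSet ((fun q : H × Z => d q.1 • q.2) ⁻¹' B) := hc.measurable hB
  have e1 : (m.prod μ) ((fun q : H × Z => d q.1 • q.2) ⁻¹' B) = μ B := by
    rw [Measure.prod_apply hmeas]
    have : ∀ x, μ (Prod.mk x ⁻¹' ((fun q : H × Z => d q.1 • q.2) ⁻¹' B)) = μ B :=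
      fun x => hinv x B hB
    simp [this]
  have e2 : (m.prod μ) ((fun q : H × Z => d q.1 • q.2) ⁻¹' B) = m ((fun u => d u • y) ⁻¹' B) := by
    rw [Measure.prod_apply_symm hmeas]
    have : ∀ᵐ z ∂μ, m ((fun x => (x, z)) ⁻¹' ((fun q : H × Z => d q.1 • q.2) ⁻¹' B)) =
        m ((fun u => d u • y) ⁻¹' B) := by
      have h0 : ∀ᵐ z ∂μ, z ∈ Set.range fun u => d u • y := by
        rw [ae_iff]; exact hcar
      filter_upwards [h0] with z hz
      obtain ⟨k, rfl⟩ := hz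
      have := hm k B hB
      refine Eq.trans ?_ this
      congr 1
      ext u
      change d u • d k • y ∈ B ↔ d (k * u) • y ∈ B
      rw [smul_smul, ← map_mul, mul_comm]
    rw [lintegral_congr_ae this]
    simp
  rw [← e1, e2]

end InvariantMeasure

/-! ### Parametrization of `A_∞` by `u ↦ [diag(u, 1)]`. -/

section Torus

variable {F : Type*} [Field F]

/-- The diagonal matrix with diagonal `(a, b)`. -/
def diagGL (a b : (KInf F)ˣ) : GL (Fin 2) (KInf F) where
  val := !![(a : KInf F), 0; 0, (b : KInf F)]
  inv := !![((a⁻¹ : (KInf F)ˣ) : KInf F), 0; 0, ((b⁻¹ : (KInf F)ˣ) : KInf F)]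
  val_inv := by simp [Matrix.one_fin_two]
  inv_val := by simp [Matrix.one_fin_two]

theorem diagGL_mul (a b a' b' : (KInf F)ˣ) :
    diagGL a b * diagGL a' b' = diagGL (a * a') (b * b') := by
  ext i j
  fin_cases i <;> fin_cases j <;> simp [diagGL]

/-- The map `u ↦ [diag(u, 1)]`, which parametrizes `A_∞`. -/
def torus : (KInf F)ˣ →* GInf F where
  toFun u := Matrix.ProjGenLinGroup.mk (diagGL u 1)
  map_one' := by
    have : diagGL (1 : (KInf F)ˣ) 1 = 1 := by
      ext i j
      fin_cases i <;> fin_cases j <;> simp [diagGL]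
    rw [this, map_one]
  map_mul' u v := by rw [← map_mul, diagGL_mul, mul_one]

theorem mk_diagGL (a b : (KInf F)ˣ) :
    Matrix.ProjGenLinGroup.mk (diagGL a b) = torus (a / b) := by
  refine (Matrix.ProjGenLinGroup.mk_eq_mk_iff.2 ⟨b, ?_⟩).symm
  ext i j
  fin_cases i <;> fin_cases j <;> simp [diagGL]

theorem continuous_torus : Continuous (torus : (KInf F)ˣ → GInf F) := by
  refine isOpenQuotientMap_mk.continuous.comp (Units.continuous_iff.2 ⟨?_, ?_⟩)
  · refine continuous_matrix fun i j => ?_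
    fin_cases i <;> fin_cases j <;> simp [diagGL] <;> fun_prop
  · refine continuous_matrix fun i j => ?_
    fin_cases i <;> fin_cases j <;> simp [diagGL, -Units.val_inv_eq_inv_val] <;>
      first
      | exact continuous_const
      | exact Units.continuous_val.comp (continuous_inv (G := (KInf F)ˣ))

theorem mem_diagSubgroup {x : GInf F} : x ∈ diagSubgroup F ↔ ∃ u, torus u = x := by
  constructor
  · rintro ⟨y, rfl⟩
    have h0 : IsUnit ((y : Fin 2 → KInf F) 0) := y.isUnit.map (Pi.evalRingHom _ 0)
    have h1 : IsUnit ((y : Fin 2 → KInf F) 1) := y.isUnit.map (Pi.evalRingHom _ 1)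
    refine ⟨h0.unit / h1.unit, ?_⟩
    rw [← mk_diagGL]
    change _ = Matrix.ProjGenLinGroup.mk _
    congr 1
    ext i j
    fin_cases i <;> fin_cases j <;> simp [diagGL]
  · rintro ⟨u, rfl⟩
    refine ⟨MulEquiv.piUnits.symm (![u, 1] : Fin 2 → (KInf F)ˣ), ?_⟩
    change Matrix.ProjGenLinGroup.mk _ = Matrix.ProjGenLinGroup.mk _
    congr 1
    ext i j
    fin_cases i <;> fin_cases j <;> simp [diagGL]

theorem orbit_diagSubgroup (y : XInf F) :
    MulAction.orbit (diagSubgroup F) y = Set.range fun u : (KInf F)ˣ => torus u • y := by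
  ext z
  constructor
  · rintro ⟨⟨a, ha⟩, rfl⟩
    obtain ⟨u, rfl⟩ := mem_diagSubgroup.1 ha
    exact ⟨u, rfl⟩
  · rintro ⟨u, rfl⟩
    exact ⟨⟨torus u, mem_diagSubgroup.2 ⟨u, rfl⟩⟩, rfl⟩

theorem IsOrbitMeasure.measure_preimage {y : XInf F} {μ : Measure (XInf F)}
    (h : IsOrbitMeasure y μ) (u : (KInf F)ˣ) {B : Set (XInf F)} (hB : MeasurableSet B) :
    μ ((fun z => torus u • z) ⁻¹' B) = μ B :=
  h.invariant.measure_preimage_smul ⟨torus u, mem_diagSubgroup.2 ⟨u, rfl⟩⟩ hB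

end Torus

/-! ### Orbits with a period: compactness and the orbit measure. -/

section PeriodicOrbit

variable {F : Type*} [Field F]

theorem isOpen_setOf_vInf_unit (s : Set ℤᵐ⁰) : IsOpen {u : (KInf F)ˣ | vInf (u : KInf F) ∈ s} := by
  rw [isOpen_iff_mem_nhds]
  intro u hu
  filter_upwards [Units.continuous_val.continuousAt.eventually (eventually_vInf_eq u.ne_zero)]
    with w hw
  rw [hw]
  exact hu

/-- The topology of the units controls the inverse too: `u ↦ (u, u⁻¹)` is a closed embedding, and
both bounds together place the image in a product of two compact balls. -/
theorem isCompact_setOf_vInf_unit [Finite F] (m n : ℤ) :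
    IsCompact {u : (KInf F)ˣ | WithZero.exp m ≤ vInf (u : KInf F) ∧
      vInf (u : KInf F) ≤ WithZero.exp n} := by
  have h := Units.isClosedEmbedding_embedProduct.isCompact_preimage
    ((isCompact_setOf_vInf_le (F := F) n).prod
      (MulOpposite.opHomeomorph.symm.isCompact_preimage.2 (isCompact_setOf_vInf_le (F := F) (-m))))
  convert h using 1
  ext u
  have hu : vInf (u : KInf F) ≠ 0 := (Valuation.ne_zero_iff _).2 u.ne_zero
  have e : vInf ((u⁻¹ : (KInf F)ˣ) : KInf F) ≤ WithZero.exp (-m) ↔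
      WithZero.exp m ≤ vInf (u : KInf F) := by
    rw [Units.val_inv_eq_inv_val, map_inv₀, WithZero.exp_neg, inv_le_inv₀ (zero_lt_iff.2 hu) (by simp)]
  rw [Set.mem_ofPred_eq, ← e, and_comm]
  rfl

/-- The shell `1 ≤ |x| < |u₀|` is a fundamental domain for the powers of `u₀`; on logarithms this is
division with remainder in `ℤ`. -/
theorem exists_zpow_mul_mem (u₀ : (KInf F)ˣ) (h1 : 1 < vInf (u₀ : KInf F)) (x : (KInf F)ˣ) :
    ∃! n : ℤ, 1 ≤ vInf ((u₀ ^ n * x : (KInf F)ˣ) : KInf F) ∧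
      vInf ((u₀ ^ n * x : (KInf F)ˣ) : KInf F) < vInf (u₀ : KInf F) := by
  obtain ⟨a, ha⟩ := exists_vInf_eq (u₀ : KInf F) u₀.ne_zero
  obtain ⟨b, hb⟩ := exists_vInf_eq (x : KInf F) x.ne_zero
  have e : ∀ n : ℤ, vInf ((u₀ ^ n * x : (KInf F)ˣ) : KInf F) = WithZero.exp (n * a + b) := by
    intro n
    rw [Units.val_mul, Units.val_zpow_eq_zpow_val, map_mul, map_zpow₀, ha, hb,
      ← WithZero.exp_zsmul, ← WithZero.exp_add, smul_eq_mul]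
  rw [ha, ← WithZero.exp_zero, WithZero.exp_lt_exp] at h1
  simp_rw [e, ha, ← WithZero.exp_zero, WithZero.exp_lt_exp, WithZero.exp_le_exp]
  have := existsUnique_add_zsmul_mem_Ico h1 b 0
  simpa [add_comm] using this

theorem torus_zpow_smul {y : XInf F} {u₀ : (KInf F)ˣ} (hy : torus u₀ • y = y) (n : ℤ) :
    torus (u₀ ^ n) • y = y := by
  have : torus u₀ ∈ MulAction.stabilizer (GInf F) y := hy
  rw [map_zpow]
  exact Subgroup.zpow_mem _ this n

theorem orbit_eq_image_of_period {y : XInf F} {u₀ : (KInf F)ˣ} (h1 : 1 < vInf (u₀ : KInf F))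
    (hy : torus u₀ • y = y) :
    MulAction.orbit (diagSubgroup F) y = (fun u : (KInf F)ˣ => torus u • y) ''
      {u : (KInf F)ˣ | 1 ≤ vInf (u : KInf F) ∧ vInf (u : KInf F) ≤ vInf (u₀ : KInf F)} := by
  rw [orbit_diagSubgroup]
  refine Set.Subset.antisymm ?_ (Set.image_subset_range _ _)
  rintro _ ⟨u, rfl⟩
  obtain ⟨n, ⟨hn1, hn2⟩, -⟩ := exists_zpow_mul_mem u₀ h1 u
  refine ⟨u₀ ^ n * u, ⟨hn1, hn2.le⟩, ?_⟩
  change torus (u₀ ^ n * u) • y = torus u • y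
  rw [mul_comm, map_mul, mul_smul, torus_zpow_smul hy]

theorem isPeriodic_of_period [Finite F] {y : XInf F} {u₀ : (KInf F)ˣ}
    (h1 : 1 < vInf (u₀ : KInf F)) (hy : torus u₀ • y = y) : IsPeriodic y := by
  obtain ⟨a, ha⟩ := exists_vInf_eq (u₀ : KInf F) u₀.ne_zero
  rw [IsPeriodic, orbit_eq_image_of_period h1 hy, ha]
  have hc : Continuous fun u : (KInf F)ˣ => torus u • y := continuous_torus.smul continuous_const
  have := isCompact_setOf_vInf_unit (F := F) 0 a
  rw [WithZero.exp_zero] at this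
  exact this.image hc

/-- The group generated by `u₀` may be smaller than the stabilizer of `y`. This is harmless: the
sets `{u | torus u • y ∈ B}` are invariant under it, and the shell is an open fundamental domain
contained in a compact set. -/
theorem existsUnique_isOrbitMeasure_of_period [Finite F] {y : XInf F} {u₀ : (KInf F)ˣ}
    (h1 : 1 < vInf (u₀ : KInf F)) (hy : torus u₀ • y = y) : ∃! μ, IsOrbitMeasure y μ := by
  let _ : MeasurableSpace (KInf F)ˣ := borel _
  have : BorelSpace (KInf F)ˣ := ⟨rfl⟩
  have : SecondCountableTopology (KInf F)ᵐᵒᵖ :=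
    MulOpposite.opHomeomorph.symm.isEmbedding.secondCountableTopology
  have : SecondCountableTopology (KInf F)ˣ := Units.isEmbedding_embedProduct.secondCountableTopology
  have hc : Continuous fun u : (KInf F)ˣ => torus u • y := continuous_torus.smul continuous_const
  set D : Set (KInf F)ˣ := {u | 1 ≤ vInf (u : KInf F) ∧ vInf (u : KInf F) < vInf (u₀ : KInf F)}
    with hD
  have hDo : IsOpen D := isOpen_setOf_vInf_unit {z | 1 ≤ z ∧ z < vInf (u₀ : KInf F)}
  obtain ⟨a, ha⟩ := exists_vInf_eq (u₀ : KInf F) u₀.ne_zero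
  have hcpt := isCompact_setOf_vInf_unit (F := F) 0 a
  rw [WithZero.exp_zero, ← ha] at hcpt
  have hfund : ∀ x : (KInf F)ˣ, ∃! g : Subgroup.zpowers u₀, (g : (KInf F)ˣ) * x ∈ D := by
    intro x
    obtain ⟨n, hn, huniq⟩ := exists_zpow_mul_mem u₀ h1 x
    refine ⟨⟨u₀ ^ n, n, rfl⟩, hn, ?_⟩
    rintro ⟨_, k, rfl⟩ hk
    exact Subtype.ext (congrArg (u₀ ^ ·) (huniq k hk))
  have : Countable (Subgroup.zpowers u₀) :=
    (Set.countable_range fun n : ℤ => u₀ ^ n).to_subtype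
  obtain ⟨m, _, hinv⟩ := exists_probability_of_fundamentalDomain (Subgroup.zpowers u₀) hDo
    ⟨1, by simp [hD, h1]⟩ hcpt (fun u hu => ⟨hu.1, hu.2.le⟩) hfund
  have hm : ∀ (h : (KInf F)ˣ) (B : Set (XInf F)), MeasurableSet B →
      m {u | torus (h * u) • y ∈ B} = m {u | torus u • y ∈ B} := by
    intro h B hB
    have hA : MeasurableSet {u | torus u • y ∈ B} := hc.measurable hB
    refine hinv h _ hA ?_
    rintro _ ⟨n, rfl⟩ x
    change torus (u₀ ^ n * x) • y ∈ B ↔ torus x • y ∈ B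
    rw [mul_comm, map_mul, mul_smul, torus_zpow_smul hy]
  have horb : MeasurableSet (MulAction.orbit (diagSubgroup F) y) := by
    exact (isPeriodic_of_period h1 hy).isClosed.measurableSet
  refine ⟨m.map fun u : (KInf F)ˣ => torus u • y, ⟨?_, ?_, ?_⟩, ?_⟩
  · exact Measure.isProbabilityMeasure_map hc.measurable.aemeasurable
  · refine ⟨fun g B hB => ?_⟩
    obtain ⟨h, hh⟩ := mem_diagSubgroup.1 g.2
    have hg : ∀ z : XInf F, g • z = torus h • z := fun z => by rw [hh]; rfl
    have hgm : Measurable fun z : XInf F => g • z := by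
      simp_rw [hg]; exact (continuous_const_smul _).measurable
    rw [Measure.map_apply hc.measurable hB, Measure.map_apply hc.measurable (hgm hB)]
    refine Eq.trans ?_ (hm h B hB)
    congr 1
    ext u
    simp [hg, mul_smul]
  · rw [Measure.map_apply hc.measurable horb.compl, orbit_diagSubgroup]
    convert measure_empty (μ := m)
    ext u
    simp
  · intro μ hμ
    have := hμ.isProbabilityMeasure
    refine eq_map_of_invariant torus continuous_torus y m hm μ
      (fun h B hB => hμ.measure_preimage h hB) ?_
    rw [← orbit_diagSubgroup]
    exact hμ.carried

end PeriodicOrbit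

/-! ### Eigenvalues of `γ₀` in `K_∞`. -/

section Diagonalization

variable {F : Type*} [Field F]

/-- Approximate solutions of `x ^ 2 - x = Y⁻²`. -/
def approxRoot (c : KInf F) : ℕ → KInf F
  | 0 => 0
  | n + 1 => approxRoot c n ^ 2 - c

/-- Fixed-point iteration for `x = x² - c`: the error is multiplied at each step by the sum of two
consecutive iterates, which has valuation at most `exp (-1)`. Unlike completing the square, this
works in characteristic `2` as well. -/
theorem approxRoot_spec {c : KInf F} (hc : vInf c ≤ WithZero.exp (-1 : ℤ)) (n : ℕ) :
    vInf (approxRoot c n) ≤ WithZero.exp (-1 : ℤ) ∧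
      vInf (approxRoot c n ^ 2 - approxRoot c n - c) ≤ WithZero.exp (-(n + 1) : ℤ) := by
  have hle : WithZero.exp (-1 : ℤ) ≤ (1 : ℤᵐ⁰) := by
    rw [← WithZero.exp_zero, WithZero.exp_le_exp]; norm_num
  induction n with
  | zero => simpa [approxRoot] using hc
  | succ n ih =>
    obtain ⟨h1, h2⟩ := ih
    have h3 : vInf (approxRoot c (n + 1)) ≤ WithZero.exp (-1 : ℤ) := by
      rw [approxRoot]
      refine (vInf.map_sub _ _).trans (max_le ?_ hc)
      rw [pow_two, map_mul]
      exact (mul_le_mul' h1 (h1.trans hle)).trans_eq (mul_one _)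
    refine ⟨h3, ?_⟩
    have e : approxRoot c (n + 1) ^ 2 - approxRoot c (n + 1) - c =
        (approxRoot c n ^ 2 - approxRoot c n - c) * (approxRoot c (n + 1) + approxRoot c n) := by
      simp only [approxRoot]; ring
    rw [e, map_mul]
    calc _ ≤ WithZero.exp (-(n + 1) : ℤ) * WithZero.exp (-1 : ℤ) :=
          mul_le_mul' h2 ((vInf.map_add _ _).trans (max_le h3 h1))
      _ = _ := by rw [← WithZero.exp_add]; push_cast; ring_nf

/-- The image of the compact ball under `x ↦ x² - x - c` is closed and contains arbitrarily small
values, hence it contains `0`. -/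
theorem exists_sq_sub_self_eq [Finite F] {c : KInf F} (hc : vInf c ≤ WithZero.exp (-1 : ℤ)) :
    ∃ x : KInf F, vInf x ≤ WithZero.exp (-1 : ℤ) ∧ x ^ 2 - x = c := by
  have hcl : IsClosed ((fun x : KInf F => x ^ 2 - x - c) '' {x | vInf x ≤ WithZero.exp (-1 : ℤ)}) :=
    ((isCompact_setOf_vInf_le (-1)).image (by fun_prop)).isClosed
  have h0 : (0 : KInf F) ∈ (fun x : KInf F => x ^ 2 - x - c) ''
      {x | vInf x ≤ WithZero.exp (-1 : ℤ)} := by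
    rw [← hcl.closure_eq, mem_closure_iff_nhds_basis hasBasis_nhds_zero_vInf]
    intro n _
    have h := approxRoot_spec hc (-n).toNat
    refine ⟨_, ⟨approxRoot c (-n).toNat, h.1, rfl⟩, h.2.trans_lt ?_⟩
    rw [WithZero.exp_lt_exp]
    have := Int.self_le_toNat (-n)
    omega
  obtain ⟨x, hx, he⟩ := h0
  exact ⟨x, hx, sub_eq_zero.1 he⟩

theorem exists_diagonalization [Finite F] :
    ∃ g : GL (Fin 2) (KInf F),
      Matrix.ProjGenLinGroup.mk (g * gamma0Inf F * g⁻¹) ∈ diagSubgroup F := by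
  set Y : KInf F := algebraMap F[X] (KInf F) X with hY
  have hY0 : Y ≠ 0 := algebraMap_inf_X_ne_zero
  -- The substitution `λ = Y x` turns the characteristic equation `λ² - Y λ - 1 = 0` into `x² - x =
  -- Y⁻²`.
  obtain ⟨x, hx, he⟩ := exists_sq_sub_self_eq (c := Y ^ (-2 : ℤ)) (F := F) (by
    rw [hY, vInf_X_zpow, WithZero.exp_le_exp]; norm_num)
  set s := Y * x with hs
  set t := Y - s with ht
  have hst : s * t = -1 := by
    have : s * t = -(Y ^ 2 * (x ^ 2 - x)) := by rw [ht, hs]; ring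
    rw [this, he]
    field_simp
  have hs0 : s ≠ 0 := by rintro h; simp [h] at hst
  have ht0 : t ≠ 0 := by rintro h; simp [h] at hst
  have hne : s - t ≠ 0 := by
    have : s - t = Y * (x + x - 1) := by rw [ht, hs]; ring
    rw [this]
    refine mul_ne_zero hY0 fun h0 => ?_
    have h1 : x + x = 1 := sub_eq_zero.1 h0
    have h2 := (vInf.map_add x x).trans (max_le hx hx)
    rw [h1, map_one, ← WithZero.exp_zero, WithZero.exp_le_exp] at h2
    norm_num at h2
  -- The vector `(λ, 1)` is an eigenvector of `γ₀` for each root `λ`.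
  let M : Matrix (Fin 2) (Fin 2) (KInf F) := !![s, t; 1, 1]
  have hM : M.det ≠ 0 := by simpa [M, Matrix.det_fin_two] using hne
  let P : GL (Fin 2) (KInf F) := Matrix.GeneralLinearGroup.mkOfDetNeZero M hM
  have key : gamma0Inf F * P = P * diagGL (Units.mk0 s hs0) (Units.mk0 t ht0) := by
    have e1 : Y * s + 1 = s * s := by linear_combination hst - s * ht
    have e2 : Y * t + 1 = t * t := by linear_combination hst - t * ht
    ext i j
    fin_cases i <;> fin_cases j <;>
      simp [Matrix.mul_apply, Fin.sum_univ_two, gamma0Inf, gamma0, P, M, diagGL, ← hY, e1, e2]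
  refine ⟨P⁻¹, mem_diagSubgroup.2 ⟨_, (mk_diagGL (Units.mk0 s hs0) (Units.mk0 t ht0)).symm.trans ?_⟩⟩
  rw [inv_inv, mul_assoc, key, inv_mul_cancel_left]

theorem exists_eq_diagGL {g : GL (Fin 2) (KInf F)}
    (hg : Matrix.ProjGenLinGroup.mk g ∈ diagSubgroup F) : ∃ a b, g = diagGL a b := by
  obtain ⟨u, hu⟩ := mem_diagSubgroup.1 hg
  obtain ⟨c, hc⟩ := Matrix.ProjGenLinGroup.mk_eq_mk_iff.1 hu
  refine ⟨u * c, c, hc.symm.trans ?_⟩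
  ext i j
  fin_cases i <;> fin_cases j <;> simp [diagGL]

/-- The trace is `Y` and the determinant is `-1`, so the two valuations are inverse to each other
and cannot both be `1`; the larger is that of `Y`. The sign `e` records which eigenvalue `g` puts
first. -/
theorem vInf_eigenvalues {g : GL (Fin 2) (KInf F)} {a b : (KInf F)ˣ}
    (h : g * gamma0Inf F * g⁻¹ = diagGL a b) :
    ∃ e : ℤ, (e = 1 ∨ e = -1) ∧ vInf (a : KInf F) = WithZero.exp e ∧
      vInf (b : KInf F) = WithZero.exp (-e) := by
  have htr : (a : KInf F) + b = algebraMap F[X] (KInf F) X := by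
    have := congrArg (fun g : GL (Fin 2) (KInf F) => (g : Matrix (Fin 2) (Fin 2) (KInf F)).trace) h
    simp only [Units.val_mul] at this
    rw [Matrix.trace_mul_comm, ← mul_assoc, Units.inv_mul, one_mul] at this
    simp [diagGL, Matrix.trace_fin_two, gamma0Inf, gamma0] at this
    exact this.symm
  have hdet : (a : KInf F) * b = -1 := by
    have := congrArg Matrix.GeneralLinearGroup.det h
    rw [map_mul, map_mul, map_inv, mul_inv_cancel_comm] at this
    have := congrArg Units.val this
    simp [diagGL, Matrix.det_fin_two, gamma0Inf, gamma0] at this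
    exact this.symm
  obtain ⟨m, hm⟩ := exists_vInf_eq (a : KInf F) a.ne_zero
  obtain ⟨n, hn⟩ := exists_vInf_eq (b : KInf F) b.ne_zero
  have hmn : m + n = 0 := by
    have := congrArg vInf hdet
    rw [map_mul, hm, hn, ← WithZero.exp_add, Valuation.map_neg, map_one, ← WithZero.exp_zero,
      WithZero.exp_inj] at this
    exact this
  obtain rfl : n = -m := by omega
  have hv := congrArg vInf htr
  rw [vInf_X] at hv
  rcases lt_trichotomy m 0 with hlt | rfl | hlt
  · rw [Valuation.map_add_eq_of_lt_right _ (by rw [hm, hn, WithZero.exp_lt_exp]; omega), hn,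
      WithZero.exp_inj] at hv
    exact ⟨m, by omega, hm, hn⟩
  · have := vInf.map_add (a : KInf F) b
    rw [hv, hm, hn, neg_zero, max_self, WithZero.exp_le_exp] at this
    norm_num at this
  · rw [Valuation.map_add_eq_of_lt_left _ (by rw [hm, hn, WithZero.exp_lt_exp]; omega), hm,
      WithZero.exp_inj] at hv
    exact ⟨m, by omega, hm, hn⟩

end Diagonalization

/-! ### Lattices in terms of matrices. -/

section Lattice

theorem mem_lattice_iff {R L : Type*} [CommRing R] [Field L] [Algebra R L] (g : GL (Fin 2) L)
    (v : Fin 2 → L) : v ∈ lattice R g ↔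
      ∃ r : Fin 2 → R, v = (g : Matrix (Fin 2) (Fin 2) L).mulVec (fun i => algebraMap R L (r i)) := by
  rw [lattice, Submodule.mem_span_range_iff_exists_fun]
  refine exists_congr fun r => ?_
  rw [eq_comm]
  have : ∑ i, r i • (fun j => (g : Matrix (Fin 2) (Fin 2) L) j i) =
      (g : Matrix (Fin 2) (Fin 2) L).mulVec (fun i => algebraMap R L (r i)) := by
    ext j
    simp [Matrix.mulVec, dotProduct, Algebra.smul_def, mul_comm]
  rw [← this]

theorem col_mem_lattice {R L : Type*} [CommRing R] [Field L] [Algebra R L] (g : GL (Fin 2) L)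
    (j : Fin 2) : (fun i => (g : Matrix (Fin 2) (Fin 2) L) i j) ∈ lattice R g :=
  Submodule.subset_span ⟨j, rfl⟩

/-- If the columns of `h` lie in `g R²`, then `h = g B` for an integral matrix `B`. -/
theorem exists_eq_mul_map {R L : Type*} [CommRing R] [Field L] [Algebra R L] {g : GL (Fin 2) L}
    {h : Matrix (Fin 2) (Fin 2) L} (hh : ∀ j, (fun i => h i j) ∈ lattice R g) :
    ∃ B : Matrix (Fin 2) (Fin 2) R,
      h = (g : Matrix (Fin 2) (Fin 2) L) * B.map (algebraMap R L) := by
  choose r hr using fun j => (mem_lattice_iff g _).1 (hh j)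
  refine ⟨Matrix.of fun i j => r j i, ?_⟩
  ext i j
  exact congrFun (hr j) i

end Lattice

/-! ### Vertices at distance `m` as integral matrices dividing `q^m`. -/

section HeckeRelation

variable {F : Type*} [Field F]

local notation "α" => algebraMap F[X] (KInf F)

theorem map_matrix_injective :
    Function.Injective fun B : Matrix (Fin 2) (Fin 2) F[X] => B.map α :=
  Matrix.map_injective algebraMap_inf_injective

theorem pt_eq_pt_iff {g h : GL (Fin 2) (KInf F)} :
    pt g = pt h ↔ ∃ (U : GL (Fin 2) F[X]) (c : (KInf F)ˣ),
      h = g * (Matrix.GeneralLinearGroup.map α U * Matrix.GeneralLinearGroup.scalar (Fin 2) c) := by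
  rw [pt, pt, QuotientGroup.eq, ← map_inv, ← map_mul, mem_GammaInf_mk, exists_comm]
  simp only [inv_mul_eq_iff_eq_mul]

theorem pt_mul_scalar (g : GL (Fin 2) (KInf F)) (c : (KInf F)ˣ) :
    pt (g * Matrix.GeneralLinearGroup.scalar (Fin 2) c) = pt g :=
  (pt_eq_pt_iff.2 ⟨1, c, by simp⟩).symm

theorem pt_mul_map (g : GL (Fin 2) (KInf F)) (U : GL (Fin 2) F[X]) :
    pt (g * Matrix.GeneralLinearGroup.map α U) = pt g :=
  (pt_eq_pt_iff.2 ⟨U, 1, by simp⟩).symm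

theorem mk_smul_pt (g h : GL (Fin 2) (KInf F)) :
    (Matrix.ProjGenLinGroup.mk g : GInf F) • pt h = pt (g * h) := rfl

/-- The inclusion `Λ' ⊆ Λ` gives `B`. Since `q` kills `Λ / Λ'`, also `q Λ ⊆ Λ'`, which gives `B'`.
This symmetric form allows an edge to be followed in either direction. -/
theorem HeckeRel.exists_matrix {ν : HeightOneSpectrum F[X]} {q : F[X]}
    (hq : ν.asIdeal = Ideal.span {q}) {x y : XInf F} (h : HeckeRel ν x y) :
    ∃ (g₁ h₁ : GL (Fin 2) (KInf F)) (B B' : Matrix (Fin 2) (Fin 2) F[X]), pt g₁ = x ∧ pt h₁ = y ∧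
      (h₁ : Matrix (Fin 2) (Fin 2) (KInf F)) = g₁ * B.map α ∧
      α q • (g₁ : Matrix (Fin 2) (Fin 2) (KInf F)) = h₁ * B'.map α ∧
      B * B' = q • (1 : Matrix (Fin 2) (Fin 2) F[X]) ∧
      B' * B = q • (1 : Matrix (Fin 2) (Fin 2) F[X]) := by
  obtain ⟨g₁, h₁, hx, hy, hle, ⟨e⟩⟩ := h
  obtain ⟨B, hB⟩ := exists_eq_mul_map (g := g₁)
    (h := (h₁ : Matrix (Fin 2) (Fin 2) (KInf F))) fun j => hle (col_mem_lattice h₁ j)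
  have hkill : ∀ v ∈ lattice F[X] g₁, q • v ∈ lattice F[X] h₁ := by
    intro v hv
    have h0 : q • (Submodule.Quotient.mk ⟨v, hv⟩ :
        lattice F[X] g₁ ⧸ (lattice F[X] h₁).submoduleOf (lattice F[X] g₁)) = 0 := by
      apply e.injective
      rw [map_smul, map_zero]
      obtain ⟨z, hz⟩ := Ideal.Quotient.mk_surjective
        (e (Submodule.Quotient.mk ⟨v, hv⟩))
      rw [← hz, Algebra.smul_def]
      change Ideal.Quotient.mk ν.asIdeal q * _ = 0
      rw [Ideal.Quotient.eq_zero_iff_mem.2 (by rw [hq]; exact Ideal.mem_span_singleton_self q),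
        zero_mul]
    rw [← Submodule.Quotient.mk_smul, Submodule.Quotient.mk_eq_zero] at h0
    exact h0
  obtain ⟨B', hB'⟩ := exists_eq_mul_map (g := h₁)
    (h := α q • (g₁ : Matrix (Fin 2) (Fin 2) (KInf F))) fun j => by
      convert hkill _ (col_mem_lattice g₁ j) using 1
      ext i
      simp [Algebra.smul_def]
  refine ⟨g₁, h₁, B, B', hx, hy, hB, hB', map_matrix_injective ?_, map_matrix_injective ?_⟩
  · apply g₁.isUnit.mul_left_cancel
    simp only [Matrix.map_mul, ← mul_assoc, ← hB, ← hB']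
    ext i j
    simp [Matrix.one_apply, mul_comm, Matrix.mul_apply, apply_ite]
  · apply h₁.isUnit.mul_left_cancel
    simp only [Matrix.map_mul, ← mul_assoc, ← hB']
    rw [Matrix.smul_mul, ← hB]
    ext i j
    simp [Matrix.one_apply, mul_comm, Matrix.mul_apply, apply_ite]

/-- `A` is integral and divides `q ^ m`. -/
def DividesPow (q : F[X]) (m : ℕ) (A : GL (Fin 2) (KInf F)) : Prop :=
  ∃ A₀ A₁ : Matrix (Fin 2) (Fin 2) F[X], (A : Matrix (Fin 2) (Fin 2) (KInf F)) = A₀.map α ∧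
    A₀ * A₁ = q ^ m • (1 : Matrix (Fin 2) (Fin 2) F[X])

theorem DividesPow.mul {q : F[X]} {m n : ℕ} {A B : GL (Fin 2) (KInf F)} (hA : DividesPow q m A)
    (hB : DividesPow q n B) : DividesPow q (m + n) (A * B) := by
  obtain ⟨A₀, A₁, hA, hA'⟩ := hA
  obtain ⟨B₀, B₁, hB, hB'⟩ := hB
  refine ⟨A₀ * B₀, B₁ * A₁, by rw [Units.val_mul, hA, hB, Matrix.map_mul], ?_⟩
  rw [mul_assoc, ← mul_assoc B₀, hB', Matrix.smul_mul, one_mul, Matrix.mul_smul, hA', smul_smul,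
    pow_add, mul_comm]

theorem DividesPow.map (q : F[X]) (U : GL (Fin 2) F[X]) :
    DividesPow q 0 (Matrix.GeneralLinearGroup.map α U) :=
  ⟨U.val, U.inv, by ext; simp, by simp⟩

theorem scalar_mul_comm (c : (KInf F)ˣ) (B : GL (Fin 2) (KInf F)) :
    Matrix.GeneralLinearGroup.scalar (Fin 2) c * B =
      B * Matrix.GeneralLinearGroup.scalar (Fin 2) c := by
  ext i j
  simp [mul_comm]

/-- Two representatives of one class differ by a unimodular `U`, which is absorbed in the product at
no cost in `m`, and by a scalar, which commutes with everything and disappears. -/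
theorem exists_dividesPow_mul {q : F[X]} {g h₁ A B : GL (Fin 2) (KInf F)} {m : ℕ}
    (hA : DividesPow q m A) (hB : DividesPow q 1 B) (h : pt h₁ = pt (g * A)) :
    ∃ A', DividesPow q (m + 1) A' ∧ pt (h₁ * B) = pt (g * A') := by
  obtain ⟨U, c, rfl⟩ := pt_eq_pt_iff.1 h.symm
  refine ⟨A * Matrix.GeneralLinearGroup.map α U * B, (hA.mul (.map q U)).mul hB, ?_⟩
  rw [← pt_mul_scalar (g * _) c]
  simp only [mul_assoc, scalar_mul_comm]

theorem exists_dividesPow_of_adj {ν : HeightOneSpectrum F[X]} {q : F[X]}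
    (hq : ν.asIdeal = Ideal.span {q}) (hq0 : q ≠ 0) {g A : GL (Fin 2) (KInf F)} {m : ℕ}
    (hA : DividesPow q m A) {y : XInf F} (h : (heckeGraph ν).Adj (pt (g * A)) y) :
    ∃ A', DividesPow q (m + 1) A' ∧ y = pt (g * A') := by
  obtain ⟨-, h | h⟩ := h
  · obtain ⟨g₁, h₁, B, B', hx, rfl, h1, h2, h3, h4⟩ := h.exists_matrix hq
    obtain ⟨A', hA', h'⟩ := exists_dividesPow_mul (B := g₁⁻¹ * h₁) hA
      ⟨B, B', by rw [Units.val_mul, h1, Units.inv_mul_cancel_left], by rw [h3, pow_one]⟩ hx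
    exact ⟨A', hA', by rw [← h', mul_inv_cancel_left]⟩
  · obtain ⟨g₁, h₁, B, B', rfl, hx, h1, h2, h3, h4⟩ := h.exists_matrix hq
    -- Here the new vertex is the larger lattice; its multiple by `q` has the same class and is the
    -- sublattice `h₁ B'` of `h₁`.
    have hc : α q ≠ 0 := (map_ne_zero_iff _ algebraMap_inf_injective).2 hq0
    have hval : ((h₁⁻¹ * (g₁ * Matrix.GeneralLinearGroup.scalar (Fin 2) (Units.mk0 _ hc)) :
        GL (Fin 2) (KInf F)) : Matrix (Fin 2) (Fin 2) (KInf F)) = B'.map α := by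
      rw [Units.val_mul, Units.inv_mul_eq_iff_eq_mul, ← h2]
      ext i j
      simp [mul_comm]
    obtain ⟨A', hA', h'⟩ := exists_dividesPow_mul hA ⟨B', B, hval, by rw [h4, pow_one]⟩ hx
    exact ⟨A', hA', by rw [← h', mul_inv_cancel_left, pt_mul_scalar]⟩

theorem exists_dividesPow_of_walk {ν : HeightOneSpectrum F[X]} {q : F[X]}
    (hq : ν.asIdeal = Ideal.span {q}) (hq0 : q ≠ 0) {g : GL (Fin 2) (KInf F)} {x y : XInf F}
    (w : (heckeGraph ν).Walk x y) {m : ℕ} {A : GL (Fin 2) (KInf F)} (hA : DividesPow q m A)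
    (hx : x = pt (g * A)) : ∃ A', DividesPow q (m + w.length) A' ∧ y = pt (g * A') := by
  induction w generalizing m A with
  | nil => exact ⟨A, hA, hx⟩
  | cons h w ih =>
    subst hx
    obtain ⟨A', hA', h'⟩ := exists_dividesPow_of_adj hq hq0 hA h
    obtain ⟨A'', hA'', h''⟩ := ih hA' h'
    refine ⟨A'', ?_, h''⟩
    rwa [SimpleGraph.Walk.length_cons, add_comm w.length, ← add_assoc]

end HeckeRelation

/-! ### Bounding Hecke distances by determinants. -/

section WalkLength

variable {F : Type*} [Field F]

local notation "α" => algebraMap F[X] (KInf F)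

/-- The quotient is cyclic, generated by the first column of `g`, with annihilator `(q)`. -/
theorem heckeRel_mul_diag {ν : HeightOneSpectrum F[X]} {q : F[X]}
    (hq : ν.asIdeal = Ideal.span {q}) {u : (KInf F)ˣ} (hu : (u : KInf F) = α q)
    (g : GL (Fin 2) (KInf F)) : HeckeRel ν (pt g) (pt (g * diagGL u 1)) := by
  have hmem : ∀ v, v ∈ lattice F[X] (g * diagGL u 1) ↔ ∃ r : Fin 2 → F[X],
      v = (g : Matrix (Fin 2) (Fin 2) (KInf F)).mulVec (fun i => α ((![q * r 0, r 1] : Fin 2 → F[X]) i)) := by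
    intro v
    rw [mem_lattice_iff]
    refine exists_congr fun r => ?_
    rw [Units.val_mul, ← Matrix.mulVec_mulVec]
    have : (diagGL u 1 : Matrix (Fin 2) (Fin 2) (KInf F)).mulVec (fun i => α (r i)) =
        fun i => α ((![q * r 0, r 1] : Fin 2 → F[X]) i) := by
      ext i
      fin_cases i <;>
        simp [diagGL, hu, Matrix.mulVec, dotProduct, Fin.sum_univ_two]
    rw [this]
  have hinj : Function.Injective (fun r : Fin 2 → F[X] =>
      (g : Matrix (Fin 2) (Fin 2) (KInf F)).mulVec (fun i => α (r i))) := by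
    intro r s h
    have := Matrix.mulVec_injective_of_isUnit g.isUnit h
    exact funext fun i => algebraMap_inf_injective (congrFun this i)
  refine ⟨g, g * diagGL u 1, rfl, rfl, ?_, ?_⟩
  · intro v hv
    obtain ⟨r, rfl⟩ := (hmem v).1 hv
    exact (mem_lattice_iff _ _).2 ⟨_, rfl⟩
  · set N := (lattice F[X] (g * diagGL u 1)).submoduleOf (lattice F[X] g)
    have hN : ∀ z : lattice F[X] g, z ∈ N ↔ (z : Fin 2 → KInf F) ∈ lattice F[X] (g * diagGL u 1) :=
      fun z => Iff.rfl
    let T : F[X] →ₗ[F[X]] (lattice F[X] g ⧸ N) :=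
      LinearMap.toSpanSingleton F[X] _ (Submodule.Quotient.mk ⟨_, col_mem_lattice g 0⟩)
    have hcol : ∀ r : F[X], r • (fun i => (g : Matrix (Fin 2) (Fin 2) (KInf F)) i 0) =
        (g : Matrix (Fin 2) (Fin 2) (KInf F)).mulVec (fun i => α ((![r, 0] : Fin 2 → F[X]) i)) := by
      intro r
      ext i
      simp [Matrix.mulVec, dotProduct, Fin.sum_univ_two, Algebra.smul_def, mul_comm]
    have hker : LinearMap.ker T = ν.asIdeal := by
      ext r
      rw [LinearMap.mem_ker, LinearMap.toSpanSingleton_apply, ← Submodule.Quotient.mk_smul,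
        Submodule.Quotient.mk_eq_zero, hq, Ideal.mem_span_singleton]
      rw [hN, Submodule.coe_smul, hmem, hcol]
      constructor
      · rintro ⟨s, hs⟩
        exact ⟨s 0, by simpa using congrFun (hinj hs) 0⟩
      · rintro ⟨s, rfl⟩
        exact ⟨![s, 0], by simp⟩
    have hsurj : Function.Surjective T := by
      intro z
      obtain ⟨⟨v, hv⟩, rfl⟩ := Submodule.Quotient.mk_surjective _ z
      obtain ⟨r, rfl⟩ := (mem_lattice_iff _ _).1 hv
      refine ⟨r 0, ?_⟩
      rw [LinearMap.toSpanSingleton_apply, ← Submodule.Quotient.mk_smul, Submodule.Quotient.eq]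
      rw [hN, Submodule.coe_sub, Submodule.coe_smul, hmem, hcol]
      refine ⟨![0, -r 1], ?_⟩
      rw [← Matrix.mulVec_sub]
      congr 1
      ext i
      fin_cases i <;> simp
    exact ⟨((Submodule.quotEquivOfEq _ _ hker.symm).trans (T.quotKerEquivOfSurjective hsurj)).symm⟩

/-- An integral matrix whose determinant is divisible by `q` is of the form `A₁ diag(q, 1) V⁻¹`. -/
theorem exists_factor {q : F[X]} (hq : Irreducible q) {A : Matrix (Fin 2) (Fin 2) F[X]}
    (h : q ∣ A.det) : ∃ (A₁ : Matrix (Fin 2) (Fin 2) F[X]) (V : GL (Fin 2) F[X]),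
      A * V = A₁ * !![q, 0; 0, 1] := by
  have hp : Prime q := hq.prime
  -- A primitive vector in the kernel of `A` modulo `q` is completed to a unimodular `V`, whose
  -- first column it is.
  suffices h' : ∃ a b : F[X], IsCoprime a b ∧ q ∣ A 0 0 * a + A 0 1 * b ∧
      q ∣ A 1 0 * a + A 1 1 * b by
    obtain ⟨a, b, ⟨x, y, hxy⟩, ⟨c, hc⟩, ⟨d, hd⟩⟩ := h'
    have hdet : IsUnit (!![a, -y; b, x] : Matrix (Fin 2) (Fin 2) F[X]).det := by
      rw [Matrix.det_fin_two_of]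
      convert isUnit_one using 1
      linear_combination hxy
    refine ⟨!![c, A 0 0 * (-y) + A 0 1 * x; d, A 1 0 * (-y) + A 1 1 * x],
      Matrix.GeneralLinearGroup.mk'' _ hdet, Matrix.ext fun i j => ?_⟩
    fin_cases i <;> fin_cases j <;>
      simp [Matrix.mul_apply, Fin.sum_univ_two, Matrix.GeneralLinearGroup.mk'', Matrix.nonsingInvUnit] <;>
      first
      | linear_combination hc
      | linear_combination hd
  -- A kernel vector that is nonzero modulo `q` becomes primitive after division by its gcd, which
  -- is prime to `q`.
  have hred : ∀ a b : F[X], ¬ (q ∣ a ∧ q ∣ b) → q ∣ A 0 0 * a + A 0 1 * b →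
      q ∣ A 1 0 * a + A 1 1 * b → ∃ a b : F[X], IsCoprime a b ∧ q ∣ A 0 0 * a + A 0 1 * b ∧
      q ∣ A 1 0 * a + A 1 1 * b := by
    intro a b hab h0 h1
    have hg0 : ¬ (a = 0 ∧ b = 0) := by rintro ⟨rfl, rfl⟩; simp at hab
    classical
    set d := EuclideanDomain.gcd a b with hd
    obtain ⟨a', ha'⟩ := EuclideanDomain.gcd_dvd_left a b
    obtain ⟨b', hb'⟩ := EuclideanDomain.gcd_dvd_right a b
    rw [← hd] at ha' hb'
    have hqd : ¬ q ∣ d := fun hqd => hab ⟨ha' ▸ hqd.mul_right _, hb' ▸ hqd.mul_right _⟩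
    have hd0 : d ≠ 0 := by rintro h; rw [h] at hqd; simp at hqd
    refine ⟨a', b', ?_, ?_, ?_⟩
    · refine ⟨EuclideanDomain.gcdA a b, EuclideanDomain.gcdB a b, mul_left_cancel₀ hd0 ?_⟩
      have := EuclideanDomain.gcd_eq_gcd_ab a b
      rw [← hd] at this
      linear_combination -this - EuclideanDomain.gcdA a b * ha' - EuclideanDomain.gcdB a b * hb'
    · refine (hp.dvd_or_dvd (a := d) ?_).resolve_left hqd
      convert h0 using 1
      linear_combination -A 0 0 * ha' - A 0 1 * hb'
    · refine (hp.dvd_or_dvd (a := d) ?_).resolve_left hqd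
      convert h1 using 1
      linear_combination -A 1 0 * ha' - A 1 1 * hb'
  rw [Matrix.det_fin_two] at h
  -- The columns of the adjugate lie in the kernel modulo `q`, as `q` divides the determinant. If
  -- both vanish modulo `q`, then so does `A`, and `(1, 0)` will do.
  by_cases h1 : q ∣ A 1 1 ∧ q ∣ -A 1 0
  · by_cases h2 : q ∣ -A 0 1 ∧ q ∣ A 0 0
    · exact ⟨1, 0, isCoprime_one_left, by simpa using h2.2, by simpa using h1.2⟩
    · refine hred _ _ h2 ?_ ?_
      · convert dvd_zero q using 1; ring
      · convert h using 1; ring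
  · refine hred _ _ h1 ?_ ?_
    · convert h using 1; ring
    · convert dvd_zero q using 1; ring

/-- Factors `diag(q, 1)` are split off one at a time. Used contrapositively: along a geodesic of
length `n`, the determinant must contain at least `q^n`. -/
theorem exists_walk_of_det {ν : HeightOneSpectrum F[X]} {q : F[X]}
    (hq : ν.asIdeal = Ideal.span {q}) (hqi : Irreducible q) (d : ℕ) :
    ∀ (h A : GL (Fin 2) (KInf F)) (A₀ : Matrix (Fin 2) (Fin 2) F[X]),
      (A : Matrix (Fin 2) (Fin 2) (KInf F)) = A₀.map α → Associated (q ^ d) A₀.det →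
      ∃ w : (heckeGraph ν).Walk (pt h) (pt (h * A)), w.length ≤ d := by
  induction d with
  | zero =>
    intro h A A₀ hA hdet
    have hu : IsUnit A₀.det := by
      rw [pow_zero] at hdet
      exact hdet.isUnit isUnit_one
    have : A = Matrix.GeneralLinearGroup.map α (Matrix.GeneralLinearGroup.mk'' A₀ hu) := by
      ext i j
      rw [hA]
      rfl
    rw [this, pt_mul_map]
    exact ⟨.nil, le_rfl⟩
  | succ d ih =>
    intro h A A₀ hA hdet
    have hdvd : q ∣ A₀.det := (Dvd.intro_left _ (pow_succ q d).symm).trans hdet.dvd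
    obtain ⟨A₁, V, hV⟩ := exists_factor hqi hdvd
    have hq0 : α q ≠ 0 := (map_ne_zero_iff _ algebraMap_inf_injective).2 hqi.ne_zero
    set D := diagGL (Units.mk0 _ hq0) 1 with hD
    have hDm : (D : Matrix (Fin 2) (Fin 2) (KInf F)) = (!![q, 0; 0, 1] : Matrix _ _ F[X]).map α := by
      ext i j
      fin_cases i <;> fin_cases j <;> simp [hD, diagGL]
    set B := A * Matrix.GeneralLinearGroup.map α V * D⁻¹ with hB
    have hBA : B * D = A * Matrix.GeneralLinearGroup.map α V := by rw [hB, inv_mul_cancel_right]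
    have hBm : (B : Matrix (Fin 2) (Fin 2) (KInf F)) = A₁.map α := by
      apply D.isUnit.mul_right_cancel
      rw [← Units.val_mul, hBA, Units.val_mul, hA, hDm, ← Matrix.map_mul, ← hV, Matrix.map_mul]
      rfl
    have hdet' : Associated (q ^ d) A₁.det := by
      have h1 := congrArg Matrix.det hV
      rw [Matrix.det_mul, Matrix.det_mul, Matrix.det_fin_two_of, mul_one, mul_zero, sub_zero] at h1
      have hVu : IsUnit V.val.det := V.isUnit.map Matrix.detMonoidHom
      have h2 : Associated (q ^ (d + 1)) (A₁.det * q) := by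
        rw [← h1]
        exact hdet.trans (associated_mul_unit_right _ _ hVu)
      rw [pow_succ] at h2
      exact h2.of_mul_right (Associated.refl q) hqi.ne_zero
    obtain ⟨w, hw⟩ := ih h B A₁ hBm hdet'
    have e : pt (h * A) = pt (h * B * D) := by
      rw [mul_assoc, hBA, ← mul_assoc, pt_mul_map]
    have hrel := heckeRel_mul_diag hq (u := Units.mk0 _ hq0) rfl (h * B)
    rw [e]
    -- A simple graph has no loops; if the two classes coincide, the shorter walk already ends at
    -- the right vertex.
    by_cases hne : pt (h * B) = pt (h * B * D)
    · rw [← hne]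
      exact ⟨w, by omega⟩
    · have hadj : (heckeGraph ν).Adj (pt (h * B)) (pt (h * B * D)) :=
        (SimpleGraph.fromRel_adj _ _ _).2 ⟨hne, Or.inl hrel⟩
      refine ⟨w.concat hadj, ?_⟩
      rw [SimpleGraph.Walk.length_concat]
      omega

end WalkLength

/-! ### Powers of `γ₀` fixing large balls of the Hecke tree. -/

section Stabilizer

variable {F : Type*} [Field F]

local notation "α" => algebraMap F[X] (KInf F)

theorem X_sq_add_four_ne_zero : (X ^ 2 + 4 : F[X]) ≠ 0 := by
  have : (X ^ 2 + 4 : F[X]) = X ^ 2 + C 4 := by rw [map_ofNat C 4]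
  rw [this]
  exact X_pow_add_C_ne_zero two_pos _

/-- The `p ^ k`-th power of `2 γ₀ = Y + N`, where `N ^ 2 = Y ^ 2 + 4`. -/
theorem gamma0_pow (p : ℕ) [Fact p.Prime] [CharP F p] (hp : Odd p) (k : ℕ) :
    (2 : F[X]) ^ p ^ k • ((gamma0 F : Matrix (Fin 2) (Fin 2) F[X]) ^ p ^ k) =
      (X : F[X]) ^ p ^ k • (1 : Matrix (Fin 2) (Fin 2) F[X]) +
        (X ^ 2 + 4 : F[X]) ^ ((p ^ k - 1) / 2) • !![X, 2; 2, -X] := by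
  set N : Matrix (Fin 2) (Fin 2) F[X] := !![X, 2; 2, -X] with hN
  have hN2 : N ^ 2 = (X ^ 2 + 4 : F[X]) • 1 := by
    rw [pow_two, hN]
    refine Matrix.ext fun i j => ?_
    fin_cases i <;> fin_cases j <;> simp [Matrix.mul_apply, Fin.sum_univ_two] <;> ring
  have h1 : (2 : F[X]) • (gamma0 F : Matrix (Fin 2) (Fin 2) F[X]) =
      (X : F[X]) • (1 : Matrix (Fin 2) (Fin 2) F[X]) + N := by
    refine Matrix.ext fun i j => ?_
    fin_cases i <;> fin_cases j <;> simp [gamma0, hN, two_mul]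
  -- Writing `p^k = 2n + 1` gives `N^(p^k) = (N²)^n N`.
  obtain ⟨n, hn⟩ := hp.pow (n := k)
  have hn' : (p ^ k - 1) / 2 = n := by omega
  have hcomm : Commute ((X : F[X]) • (1 : Matrix (Fin 2) (Fin 2) F[X])) N :=
    (Commute.one_left N).smul_left (X : F[X])
  rw [← _root_.smul_pow, h1, add_pow_char_pow_of_commute _ _ hcomm, _root_.smul_pow, one_pow, hn']
  congr 1
  rw [hn, pow_succ, pow_mul, hN2, _root_.smul_pow, one_pow, Matrix.smul_mul, one_mul]

/-- Up to a constant, `γ₀^(p^k)` is `Y^(p^k) + q^n N` with `q = Y² + 4`. As `A⁻¹ = q^(-m) A₁`,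
conjugating by `A` turns the second term into `q^(n-m) A₁ N A₀`, which is integral because `m ≤ n`.
-/
theorem exists_gamma0_pow_mul (p : ℕ) [Fact p.Prime] [CharP F p] (hp : Odd p) (k : ℕ) {m : ℕ}
    (hm : m ≤ (p ^ k - 1) / 2) {A : GL (Fin 2) (KInf F)} (hA : DividesPow (X ^ 2 + 4 : F[X]) m A) :
    ∃ B : GL (Fin 2) F[X],
      gamma0Inf F ^ p ^ k * A = A * Matrix.GeneralLinearGroup.map α B := by
  obtain ⟨A₀, A₁, hA, hA'⟩ := hA
  have h2 : (2 : F) ≠ 0 := by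
    rw [← Nat.cast_two, Ne, CharP.cast_eq_zero_iff F p]
    intro h
    rcases (Nat.dvd_prime Nat.prime_two).1 h with h | h
    · exact (Fact.out : p.Prime).ne_one h
    · rw [h] at hp; exact absurd hp (by decide)
  set c : F[X] := C ((2 ^ p ^ k)⁻¹ : F) with hc
  have hc2 : c * 2 ^ p ^ k = 1 := by
    have : (2 : F[X]) = C 2 := (map_ofNat C 2).symm
    rw [hc, this, ← C_pow, ← C_mul, inv_mul_cancel₀ (pow_ne_zero _ h2), C_1]
  set n := (p ^ k - 1) / 2 with hn
  set G : Matrix (Fin 2) (Fin 2) F[X] := (gamma0 F : Matrix (Fin 2) (Fin 2) F[X]) ^ p ^ k with hG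
  set N : Matrix (Fin 2) (Fin 2) F[X] := !![X, 2; 2, -X]
  have hpow := gamma0_pow (F := F) p hp k
  have hG' : G = c • ((X : F[X]) ^ p ^ k • (1 : Matrix (Fin 2) (Fin 2) F[X]) +
        (X ^ 2 + 4 : F[X]) ^ n • N) := by
    rw [← hpow, smul_smul, hc2, one_smul]
  set B₀ := c • ((X : F[X]) ^ p ^ k • (1 : Matrix (Fin 2) (Fin 2) F[X]) +
        (X ^ 2 + 4 : F[X]) ^ (n - m) • (A₁ * (N * A₀))) with hB₀
  have key : G * A₀ = A₀ * B₀ := by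
    rw [hG', hB₀, Matrix.smul_mul, Matrix.mul_smul, Matrix.add_mul, Matrix.mul_add,
      Matrix.smul_mul, Matrix.smul_mul, Matrix.mul_smul, Matrix.mul_smul, one_mul, mul_one,
      ← mul_assoc A₀ A₁, hA', Matrix.smul_mul, one_mul, smul_smul, ← pow_add, Nat.sub_add_cancel hm]
  have hdet0 : A₀.det ≠ 0 := by
    intro h0
    have := congrArg Matrix.det hA'
    rw [Matrix.det_mul, h0, zero_mul, Matrix.det_smul, Matrix.det_one, mul_one] at this
    exact pow_ne_zero _ (pow_ne_zero _ X_sq_add_four_ne_zero) this.symm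
  -- Conjugate matrices have equal determinants, and that of `γ₀^(p^k)` is a unit.
  have hdet : IsUnit B₀.det := by
    have h := congrArg Matrix.det key
    rw [Matrix.det_mul, Matrix.det_mul, mul_comm] at h
    rw [← mul_left_cancel₀ hdet0 h, hG]
    exact ((gamma0 F).isUnit.pow _).map Matrix.detMonoidHom
  refine ⟨Matrix.GeneralLinearGroup.mk'' B₀ hdet, Units.ext ?_⟩
  have hmap : (gamma0Inf F ^ p ^ k : GL (Fin 2) (KInf F)).val = G.map α := by
    rw [gamma0Inf, ← map_pow, hG, ← Units.val_pow_eq_pow_val]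
    rfl
  rw [Units.val_mul, Units.val_mul, hmap, hA, ← Matrix.map_mul, key, Matrix.map_mul]
  rfl

theorem torus_pow_smul_pt (p : ℕ) [Fact p.Prime] [CharP F p] (hp : Odd p) (k : ℕ) {m : ℕ}
    (hm : m ≤ (p ^ k - 1) / 2) {g A : GL (Fin 2) (KInf F)} {a b : (KInf F)ˣ}
    (hg : g * gamma0Inf F * g⁻¹ = diagGL a b) (hA : DividesPow (X ^ 2 + 4 : F[X]) m A) :
    torus ((a / b) ^ p ^ k) • pt (g * A) = pt (g * A) := by
  obtain ⟨B, hB⟩ := exists_gamma0_pow_mul p hp k hm hA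
  rw [map_pow, ← mk_diagGL, ← hg, ← map_pow, mk_smul_pt, conj_pow]
  simp only [mul_assoc, inv_mul_cancel_left]
  rw [hB, ← mul_assoc, pt_mul_map]

end Stabilizer

/-! ### Rational ends: a common vector and growing determinants. -/

section RationalEnd

variable {F : Type*} [Field F] {ν : HeightOneSpectrum F[X]}

local notation "α" => algebraMap F[X] (KInf F)

/-- The embedding of `F[Y][1/ν]` in `K_ν`. -/
def sIntToNu (ν : HeightOneSpectrum F[X]) : SInt ν →+* KNu ν :=
  (algebraMap (RatFunc F) (KNu ν)).comp (algebraMap (SInt ν) (RatFunc F))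

/-- The embedding of `F[Y][1/ν]` in `K_∞`. -/
def sIntToInf (ν : HeightOneSpectrum F[X]) : SInt ν →+* KInf F :=
  (algebraMap (RatFunc F) (KInf F)).comp (algebraMap (SInt ν) (RatFunc F))

theorem sIntToInf_algebraMap (P : F[X]) : sIntToInf ν (algebraMap F[X] (SInt ν) P) = α P := rfl

theorem sIntToNu_algebraMap (P : F[X]) :
    sIntToNu ν (algebraMap F[X] (SInt ν) P) = algebraMap F[X] (KNu ν) P := rfl

theorem exists_polynomial_of_mem {z : SInt ν} (hz : Valued.v (sIntToNu ν z) ≤ 1) :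
    ∃ P : F[X], algebraMap F[X] (SInt ν) P = z := by
  obtain ⟨P, hP⟩ := HeightOneSpectrum.mem_integers_of_valuation_le_one (R := F[X]) (RatFunc F)
    (z : RatFunc F) (fun v => by
      by_cases h : v = ν
      · subst h
        rw [← HeightOneSpectrum.valuedAdicCompletion_eq_valuation']
        exact hz
      · exact Set.integer_valuation_le_one _ _ z h)
  exact ⟨P, Subtype.ext hP⟩

/-- An irreducible factor `r` of `P` not associated to `q` would give `P` a valuation less than `1`
at `r`, whereas the inverse of `P` is integral there. -/
theorem exists_associated_pow_of_isUnit {q : F[X]} (hq : ν.asIdeal = Ideal.span {q})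
    (hqi : Irreducible q) {P : F[X]} (hP : IsUnit (algebraMap F[X] (SInt ν) P)) :
    ∃ d, Associated (q ^ d) P := by
  have hP0 : P ≠ 0 := by rintro rfl; simp at hP
  obtain ⟨d, P', hd, rfl⟩ := WfDvdMonoid.max_power_factor hP0 hqi
  refine ⟨d, associated_mul_unit_right _ _ ?_⟩
  by_contra hu
  have hP'0 : P' ≠ 0 := by rintro rfl; simp at hP0
  obtain ⟨r, hr, hrP⟩ := WfDvdMonoid.exists_irreducible_factor hu hP'0
  let v : HeightOneSpectrum F[X] := ⟨Ideal.span {r}, (Ideal.span_singleton_prime hr.ne_zero).2 hr.prime,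
    by simpa using hr.ne_zero⟩
  have hv : v ∉ ({ν} : Set (HeightOneSpectrum F[X])) := by
    rintro (rfl : v = ν)
    have : Ideal.span {r} = Ideal.span {q} := hq
    rw [Ideal.span_singleton_eq_span_singleton] at this
    exact hd (this.symm.dvd.trans hrP)
  obtain ⟨e, he⟩ := hP.exists_right_inv
  have h1 : v.valuation (RatFunc F) (algebraMap F[X] (RatFunc F) (q ^ d * P')) < 1 := by
    rw [HeightOneSpectrum.valuation_lt_one_iff_mem]
    exact Ideal.mem_span_singleton.2 (hrP.mul_left _)
  have h2 := Set.integer_valuation_le_one _ (RatFunc F) e hv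
  have h3 : algebraMap F[X] (RatFunc F) (q ^ d * P') * (e : RatFunc F) = 1 :=
    congrArg Subtype.val he
  have h4 := congrArg (v.valuation (RatFunc F)) h3
  rw [map_mul, map_one] at h4
  exact absurd h4 (mul_lt_one_of_lt_of_le h1 h2).ne

theorem exists_pow_le {q : F[X]} (hq : ν.asIdeal = Ideal.span {q}) {c : KNu ν} (hc : c ≠ 0) (hq0 : q ≠ 0) :
    ∃ N : ℕ, Valued.v (algebraMap F[X] (KNu ν) (q ^ N)) ≤ Valued.v c := by
  have h1 : Valued.v (algebraMap F[X] (KNu ν) q) = WithZero.exp (-1 : ℤ) :=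
    (HeightOneSpectrum.valuedAdicCompletion_eq_valuation ν q).trans
      ((HeightOneSpectrum.valuation_of_algebraMap ν q).trans
        (HeightOneSpectrum.intValuation_singleton ν hq0 hq))
  have hv : Valued.v c ≠ 0 := (Valuation.ne_zero_iff _).2 hc
  refine ⟨(-WithZero.log (Valued.v c)).toNat, ?_⟩
  rw [map_pow, map_pow, h1, ← WithZero.exp_log hv, ← WithZero.exp_nsmul, WithZero.exp_le_exp,
    WithZero.log_exp, nsmul_eq_mul]
  have := Int.self_le_toNat (-WithZero.log (Valued.v c))
  linarith

/-- A nonzero polynomial vector in all the lattices of a ray ending at a rational point. -/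
theorem exists_polynomial_vector {q : F[X]} (hq : ν.asIdeal = Ideal.span {q}) (hq0 : q ≠ 0)
    (ξ : ℙ (RatFunc F) (Fin 2 → RatFunc F)) {N : Submodule (ONu ν) (Fin 2 → KNu ν)}
    (hN : Submodule.span (KNu ν) (N : Set (Fin 2 → KNu ν)) = (ratPoint ν ξ).submodule) :
    ∃ P : Fin 2 → F[X], P ≠ 0 ∧ (fun i => algebraMap F[X] (KNu ν) (P i)) ∈ N := by
  induction ξ using Projectivization.ind with | h v hv =>
  set v' : Fin 2 → KNu ν := fun i => algebraMap (RatFunc F) (KNu ν) (v i) with hv'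
  replace hN : Submodule.span (KNu ν) (N : Set (Fin 2 → KNu ν)) =
    Submodule.span (KNu ν) {v'} := hN
  have hv'0 : v' ≠ 0 := by
    intro h
    exact hv (funext fun i => (algebraMap (RatFunc F) (KNu ν)).injective
      ((congrFun h i).trans (map_zero _).symm))
  obtain ⟨u, huN, hu0⟩ : ∃ u ∈ N, u ≠ 0 := by
    by_contra! h
    have : (N : Set (Fin 2 → KNu ν)) ⊆ {0} := fun u hu => h u hu
    have h2 : Submodule.span (KNu ν) (N : Set (Fin 2 → KNu ν)) = ⊥ :=
      Submodule.span_eq_bot.2 this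
    rw [hN] at h2
    exact hv'0 (Submodule.span_singleton_eq_bot.1 h2)
  have hmem : u ∈ Submodule.span (KNu ν) {v'} := by
    have := Submodule.subset_span (R := KNu ν) huN
    rw [hN] at this
    exact this
  obtain ⟨c, rfl⟩ := Submodule.mem_span_singleton.1 hmem
  have hc : c ≠ 0 := by rintro rfl; simp at hu0
  -- The nonzero `u = c v'` lies in `N`. The polynomial `d` clears the denominators of `v`, and
  -- `q^k` makes `q^k c⁻¹` integral at `ν`, so `q^k d v'` is an `O_ν`-multiple of `u`.
  obtain ⟨k, hk⟩ := exists_pow_le hq hc hq0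
  obtain ⟨⟨d, hd⟩, hdv⟩ := IsLocalization.exist_integer_multiples_of_finite
    (nonZeroDivisors F[X]) v
  choose P hP using hdv
  have hd0 : d ≠ 0 := nonZeroDivisors.ne_zero hd
  refine ⟨fun i => q ^ k * P i, ?_, ?_⟩
  · intro h
    apply hv
    funext i
    have h1 : P i = 0 := by
      have := congrFun h i
      simpa [hq0] using this
    have h2 := hP i
    rw [h1, map_zero] at h2
    have h3 : d • v i = 0 := h2.symm
    simpa [hd0] using h3
  · have e : (fun i => algebraMap F[X] (KNu ν) (q ^ k * P i)) =
        (algebraMap F[X] (KNu ν) (q ^ k) * c⁻¹ * algebraMap F[X] (KNu ν) d) • c • v' := by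
      funext i
      have h3 : algebraMap F[X] (RatFunc F) (P i) = d • v i := hP i
      rw [map_mul, IsScalarTower.algebraMap_apply F[X] (RatFunc F) (KNu ν) (P i), h3,
        Algebra.smul_def, map_mul, ← IsScalarTower.algebraMap_apply]
      simp only [Pi.smul_apply, smul_eq_mul, hv']
      field_simp
    rw [e]
    have hint : algebraMap F[X] (KNu ν) (q ^ k) * c⁻¹ * algebraMap F[X] (KNu ν) d ∈ ν.adicCompletionIntegers (RatFunc F) := by
      refine mul_mem ?_ (HeightOneSpectrum.coe_mem_adicCompletionIntegers _ _)
      rw [HeightOneSpectrum.mem_adicCompletionIntegers, map_mul, map_inv₀]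
      rw [← div_eq_mul_inv]
      exact div_le_one_of_le₀ hk zero_le
    exact N.smul_mem (⟨_, hint⟩ : ONu ν) huN

theorem exists_polynomial_matrix {B : GL (Fin 2) (SInt ν)}
    (hB : ∀ i j, Valued.v (sIntToNu ν ((B : Matrix (Fin 2) (Fin 2) (SInt ν)) i j)) ≤ 1) :
    ∃ B₀ : Matrix (Fin 2) (Fin 2) F[X],
      (B : Matrix (Fin 2) (Fin 2) (SInt ν)) = B₀.map (algebraMap F[X] (SInt ν)) := by
  choose B₀ hB₀ using fun i j => exists_polynomial_of_mem (hB i j)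
  exact ⟨Matrix.of B₀, Matrix.ext fun i j => (hB₀ i j).symm⟩

theorem toNu_apply (γ : GL (Fin 2) (SInt ν)) :
    (toNu ν γ : Matrix (Fin 2) (Fin 2) (KNu ν)) = (γ : Matrix _ _ (SInt ν)).map (sIntToNu ν) := rfl

theorem toInf_apply (γ : GL (Fin 2) (SInt ν)) :
    (toInf ν γ : Matrix (Fin 2) (Fin 2) (KInf F)) = (γ : Matrix _ _ (SInt ν)).map (sIntToInf ν) :=
  rfl

/-- The entries of `γ⁻¹ δ` lie in `F[Y][1/ν]`, and by the inclusion also in `O_ν`; the intersection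
of these rings is `F[Y]`. -/
theorem exists_matrix_of_lattice_le {γ δ : GL (Fin 2) (SInt ν)}
    (h : lattice (ONu ν) (toNu ν δ) ≤ lattice (ONu ν) (toNu ν γ)) :
    ∃ B₀ : Matrix (Fin 2) (Fin 2) F[X],
      ((γ⁻¹ * δ : GL (Fin 2) (SInt ν)) : Matrix (Fin 2) (Fin 2) (SInt ν)) =
        B₀.map (algebraMap F[X] (SInt ν)) := by
  obtain ⟨C, hC⟩ := exists_eq_mul_map (g := toNu ν γ)
    (h := (toNu ν δ : Matrix (Fin 2) (Fin 2) (KNu ν))) fun j => h (col_mem_lattice _ j)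
  apply exists_polynomial_matrix
  intro i j
  have h1 : (toNu ν (γ⁻¹ * δ) : Matrix (Fin 2) (Fin 2) (KNu ν)) =
      C.map (algebraMap (ONu ν) (KNu ν)) := by
    rw [map_mul, map_inv, Units.val_mul, Units.inv_mul_eq_iff_eq_mul, hC]
  have h2 := congrFun (congrFun h1 i) j
  rw [toNu_apply, Matrix.map_apply] at h2
  rw [h2]
  exact (C i j).2

/-- Transfer from `ν` to infinity: the coordinates of `P` in the basis `γ` are in `F[Y][1/ν]` and
integral at `ν`, so they are polynomials, and the same relation can be read in `K_∞`. -/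
theorem exists_mulVec_eq {γ : GL (Fin 2) (SInt ν)} {P : Fin 2 → F[X]}
    (h : (fun i => algebraMap F[X] (KNu ν) (P i)) ∈ lattice (ONu ν) (toNu ν γ)) :
    (fun i => α (P i)) ∈ lattice F[X] (toInf ν γ) := by
  obtain ⟨r, hr⟩ := (mem_lattice_iff _ _).1 h
  set z : Fin 2 → SInt ν := ((γ⁻¹ : GL (Fin 2) (SInt ν)) : Matrix (Fin 2) (Fin 2) (SInt ν)).mulVec
    (fun i => algebraMap F[X] (SInt ν) (P i)) with hz
  have hγz : (γ : Matrix (Fin 2) (Fin 2) (SInt ν)).mulVec z =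
      fun i => algebraMap F[X] (SInt ν) (P i) := by
    rw [hz, Matrix.mulVec_mulVec, Units.mul_inv, Matrix.one_mulVec]
  have hzr : (fun i => sIntToNu ν (z i)) = fun i => algebraMap (ONu ν) (KNu ν) (r i) := by
    apply Matrix.mulVec_injective_of_isUnit (toNu ν γ).isUnit
    rw [← hr, toNu_apply]
    funext i
    rw [← sIntToNu_algebraMap, ← congrFun hγz i, RingHom.map_mulVec]
    rfl
  have hint : ∀ i, ∃ Q : F[X], algebraMap F[X] (SInt ν) Q = z i := fun i =>
    exists_polynomial_of_mem (by rw [congrFun hzr i]; exact (r i).2)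
  choose Q hQ using hint
  refine (mem_lattice_iff _ _).2 ⟨Q, funext fun i => ?_⟩
  rw [← sIntToInf_algebraMap, ← congrFun hγz i, RingHom.map_mulVec, toInf_apply]
  congr 1
  funext j
  rw [Function.comp_apply, ← hQ, sIntToInf_algebraMap]

/-- The lattices of a ray with a rational end have a common nonzero vector, while their covolumes
go to zero. -/
theorem exists_lattices_of_ray {q : F[X]} (hq : ν.asIdeal = Ideal.span {q}) (hqi : Irreducible q)
    {x₀ : XInf F} {x : ℕ → XInf F} (hx : IsHeckeRay ν x₀ x) (hr : IsRationalRay ν x) :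
    ∃ (h : ℕ → GL (Fin 2) (KInf F)) (w : Fin 2 → KInf F), w ≠ 0 ∧ ∀ n, pt (h n) = x n ∧
      w ∈ lattice F[X] (h n) ∧
      vInf (h 0 : Matrix (Fin 2) (Fin 2) (KInf F)).det * WithZero.exp (n * q.natDegree : ℤ) ≤
        vInf (h n : Matrix (Fin 2) (Fin 2) (KInf F)).det := by
  obtain ⟨g, hg, ξ, M, hM, hγ, hspan⟩ := hr
  choose γ hγM hγx using hγ
  obtain ⟨P, hP0, hP⟩ := exists_polynomial_vector hq hqi.ne_zero ξ hspan
  refine ⟨fun n => g * toInf ν (γ n), (g : Matrix _ _ (KInf F)).mulVec fun i => α (P i), ?_,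
    fun n => ⟨hγx n, ?_, ?_⟩⟩
  · intro h0
    rw [← Matrix.mulVec_zero (g : Matrix (Fin 2) (Fin 2) (KInf F))] at h0
    have := Matrix.mulVec_injective_of_isUnit g.isUnit h0
    exact hP0 (funext fun i => algebraMap_inf_injective ((congrFun this i).trans (map_zero _).symm))
  · have hPn : (fun i => algebraMap F[X] (KNu ν) (P i)) ∈ lattice (ONu ν) (toNu ν (γ n)) := by
      rw [hγM n]
      exact (Submodule.mem_iInf _).1 hP n
    obtain ⟨r, hr⟩ := (mem_lattice_iff _ _).1 (exists_mulVec_eq hPn)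
    rw [mem_lattice_iff]
    exact ⟨r, by rw [hr, Matrix.mulVec_mulVec, Units.val_mul]⟩
  · obtain ⟨A₀, hA₀⟩ := exists_matrix_of_lattice_le (γ := γ 0) (δ := γ n) (by
      rw [hγM, hγM]; exact hM (Nat.zero_le n))
    have hdetA : algebraMap F[X] (SInt ν) A₀.det =
        ((γ 0)⁻¹ * γ n : GL (Fin 2) (SInt ν)).val.det := by
      rw [hA₀, RingHom.map_det]; rfl
    -- The transition matrix is invertible over `F[Y][1/ν]`, so its polynomial determinant is a
    -- power of `q` up to a constant.
    obtain ⟨d, hd⟩ := exists_associated_pow_of_isUnit hq hqi (P := A₀.det) (by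
      rw [hdetA]; exact (Matrix.isUnit_iff_isUnit_det _).1 (Units.isUnit _))
    have hA : (toInf ν ((γ 0)⁻¹ * γ n) : Matrix (Fin 2) (Fin 2) (KInf F)) = A₀.map α := by
      rw [toInf_apply, hA₀]; rfl
    have hmul : g * toInf ν (γ n) = g * toInf ν (γ 0) * toInf ν ((γ 0)⁻¹ * γ n) := by
      rw [mul_assoc, ← map_mul, mul_inv_cancel_left]
    have hwalk := exists_walk_of_det hq hqi d (g * toInf ν (γ 0)) _ A₀ hA hd
    rw [← hmul] at hwalk
    obtain ⟨w, hw⟩ := hwalk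
    -- The chain of lattices is only required to be antitone, so `d` is not determined; the geodesic
    -- property yields the lower bound, which suffices.
    have hnd : n ≤ d := by
      have h1 := hx.2 0 n
      rw [zero_add, ← hγx 0, ← hγx n] at h1
      rw [← h1]
      exact (SimpleGraph.dist_le w).trans hw
    have hA0 : A₀.det ≠ 0 := fun h0 => pow_ne_zero d hqi.ne_zero (hd.eq_zero_iff.2 h0)
    have hdet : vInf (α A₀.det) = WithZero.exp (d * q.natDegree : ℤ) := by
      rw [vInf_algebraMap hA0, ← natDegree_eq_of_degree_eq (degree_eq_degree_of_associated hd),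
        natDegree_pow]
      push_cast
      rfl
    simp only
    rw [hmul, Units.val_mul _ (toInf ν ((γ 0)⁻¹ * γ n)), Matrix.det_mul, map_mul, hA]
    have : (A₀.map α).det = α A₀.det := by rw [RingHom.map_det]; rfl
    rw [this, hdet]
    gcongr
    rw [WithZero.exp_le_exp]
    gcongr

end RationalEnd

/-! ### The thick parts exhaust `X_∞` (easy half of Mahler's criterion). -/

section Compactness

variable {F : Type*} [Field F]

local notation "α" => algebraMap F[X] (KInf F)

/-- The nonzero vectors `v` of the lattice `h F[Y]²` satisfy `‖v‖ ^ 2 ≥ q ^ (-T) covol`. -/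
def IsThick (T : ℕ) (h : GL (Fin 2) (KInf F)) : Prop :=
  ∀ r : Fin 2 → F[X], r ≠ 0 → ∃ i, WithZero.exp (-T : ℤ) *
    vInf (h : Matrix (Fin 2) (Fin 2) (KInf F)).det ≤
      vInf ((h : Matrix (Fin 2) (Fin 2) (KInf F)).mulVec (fun j => α (r j)) i) ^ 2

/-- The classes of the lattices satisfying `IsThick`. -/
def thickPart (F : Type*) [Field F] (T : ℕ) : Set (XInf F) := pt '' {h | IsThick T h}

/-- The matrix `U` permutes the nonzero integral vectors and has constant determinant, while `c`
multiplies both sides of the inequality by `|c|²`. -/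
theorem IsThick.mul_map_scalar {T : ℕ} {h : GL (Fin 2) (KInf F)} (hh : IsThick T h)
    (U : GL (Fin 2) F[X]) (c : (KInf F)ˣ) :
    IsThick T (h * (Matrix.GeneralLinearGroup.map α U *
      Matrix.GeneralLinearGroup.scalar (Fin 2) c)) := by
  intro r hr
  have hr' : U.val.mulVec r ≠ 0 := by
    intro h0
    rw [← Matrix.mulVec_zero U.val] at h0
    exact hr (Matrix.mulVec_injective_of_isUnit U.isUnit h0)
  obtain ⟨i, hi⟩ := hh _ hr'
  refine ⟨i, ?_⟩
  have e1 : ((h * (Matrix.GeneralLinearGroup.map α U *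
      Matrix.GeneralLinearGroup.scalar (Fin 2) c) : GL (Fin 2) (KInf F)) :
        Matrix (Fin 2) (Fin 2) (KInf F)) = c.val • (h.val * U.val.map α) := by
    refine Matrix.ext fun i j => ?_
    fin_cases j <;> simp [Matrix.mul_apply, Fin.sum_univ_two] <;> ring
  have e2 : (U.val.map α).mulVec (fun j => α (r j)) = fun j => α (U.val.mulVec r j) := by
    funext i
    exact (RingHom.map_mulVec α U.val r i).symm
  have e3 : (U.val.map α).det = α U.val.det := by rw [RingHom.map_det]; rfl
  rw [e1, Matrix.det_smul, Matrix.smul_mulVec, Matrix.det_mul, e3, ← Matrix.mulVec_mulVec, e2,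
    Pi.smul_apply, smul_eq_mul, map_mul, map_mul, map_mul, vInf_det_map, mul_one, map_pow,
    Fintype.card_fin, mul_pow, mul_left_comm]
  gcongr

theorem pt_mem_thickPart {T : ℕ} {h : GL (Fin 2) (KInf F)} : pt h ∈ thickPart F T ↔ IsThick T h := by
  refine ⟨?_, fun hh => ⟨h, hh, rfl⟩⟩
  rintro ⟨h', hh', he⟩
  obtain ⟨U, c, rfl⟩ := pt_eq_pt_iff.1 he
  exact hh'.mul_map_scalar U c

/-- In an ultrametric norm, a matrix close to the identity perturbs a vector by strictly less than
its largest coordinate, whose size is therefore preserved. -/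
theorem exists_vInf_mulVec_eq {k : Matrix (Fin 2) (Fin 2) (KInf F)}
    (hk : ∀ i j, vInf (k i j - (1 : Matrix (Fin 2) (Fin 2) (KInf F)) i j) < 1) (u : Fin 2 → KInf F) :
    ∃ i, (∀ j, vInf (u j) ≤ vInf (u i)) ∧ vInf (k.mulVec u i) = vInf (u i) := by
  obtain ⟨i, hi⟩ := Finite.exists_max fun i => vInf (u i)
  refine ⟨i, hi, ?_⟩
  by_cases h0 : vInf (u i) = 0
  · have : u = 0 := funext fun j => (Valuation.zero_iff vInf).1 (le_antisymm (h0 ▸ hi j) zero_le)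
    simp [this]
  · apply Valuation.map_eq_of_sub_lt
    have e : k.mulVec u i - u i = ∑ j, (k i j - (1 : Matrix (Fin 2) (Fin 2) (KInf F)) i j) * u j := by
      have : u i = (1 : Matrix (Fin 2) (Fin 2) (KInf F)).mulVec u i := by rw [Matrix.one_mulVec]
      rw [this, Matrix.mulVec, Matrix.mulVec, dotProduct, dotProduct, ← Finset.sum_sub_distrib]
      exact Finset.sum_congr rfl fun j _ => (sub_mul _ _ _).symm
    rw [e]
    refine Valuation.map_sum_lt _ h0 fun j _ => ?_
    rw [map_mul]
    calc _ ≤ vInf (k i j - (1 : Matrix (Fin 2) (Fin 2) (KInf F)) i j) * vInf (u i) := by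
          gcongr; exact hi j
      _ < 1 * vInf (u i) := by
          exact mul_lt_mul_of_pos_right (hk i j) (zero_lt_iff.2 h0)
      _ = vInf (u i) := one_mul _

theorem isOpen_thickPart (T : ℕ) : IsOpen (thickPart F T) := by
  refine isOpenQuotientMap_pt.isOpenMap _ (isOpen_iff_mem_nhds.2 fun h hh => ?_)
  have hc : Tendsto (fun h' : GL (Fin 2) (KInf F) => h' * h⁻¹) (𝓝 h) (𝓝 1) := by
    have : Continuous fun h' : GL (Fin 2) (KInf F) => h' * h⁻¹ := continuous_mul_const _
    simpa using this.tendsto h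
  filter_upwards [hc.eventually eventually_near_one] with h' hh' r hr
  obtain ⟨i, hi⟩ := hh r hr
  obtain ⟨i', hmax, heq⟩ := exists_vInf_mulVec_eq hh'.1
    ((h : Matrix (Fin 2) (Fin 2) (KInf F)).mulVec (fun j => α (r j)))
  refine ⟨i', ?_⟩
  have e : (h' : Matrix (Fin 2) (Fin 2) (KInf F)) = (h' * h⁻¹ : GL (Fin 2) (KInf F)).val * h.val := by
    rw [← Units.val_mul, inv_mul_cancel_right]
  rw [e, Matrix.det_mul, map_mul, hh'.2, one_mul, ← Matrix.mulVec_mulVec, heq]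
  exact hi.trans (pow_le_pow_left' (hmax i) 2)

theorem IsThick.mono {T T' : ℕ} (hT : T ≤ T') {h : GL (Fin 2) (KInf F)} (hh : IsThick T h) :
    IsThick T' h := by
  intro r hr
  obtain ⟨i, hi⟩ := hh r hr
  refine ⟨i, le_trans ?_ hi⟩
  gcongr
  rw [WithZero.exp_le_exp]
  omega

theorem exists_vInf_le {ι : Type*} [Finite ι] (f : ι → KInf F) :
    ∃ n : ℕ, ∀ i, vInf (f i) ≤ WithZero.exp (n : ℤ) := by
  have h : ∀ i, ∃ n : ℕ, vInf (f i) ≤ WithZero.exp (n : ℤ) := by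
    intro i
    by_cases h0 : f i = 0
    · exact ⟨0, by simp [h0]⟩
    · obtain ⟨n, hn⟩ := exists_vInf_eq _ h0
      exact ⟨n.toNat, by rw [hn, WithZero.exp_le_exp]; exact Int.self_le_toNat n⟩
  choose n hn using h
  obtain ⟨N, hN⟩ := (Set.finite_range n).bddAbove
  refine ⟨N, fun i => (hn i).trans ?_⟩
  rw [WithZero.exp_le_exp]
  exact_mod_cast hN ⟨i, rfl⟩

/-- A nonzero polynomial vector has a coordinate of valuation at least `1`, and it is recovered from
its image by `h⁻¹`, whose entries are bounded; so the image cannot be too short. -/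
theorem exists_isThick (h : GL (Fin 2) (KInf F)) : ∃ T, IsThick T h := by
  obtain ⟨n, hn⟩ := exists_vInf_le fun ij : Fin 2 × Fin 2 => (h⁻¹).val ij.1 ij.2
  obtain ⟨m, hm⟩ := exists_vInf_le fun _ : Unit => h.val.det
  refine ⟨m + 2 * n, fun r hr => ?_⟩
  obtain ⟨i, hi⟩ := Function.ne_iff.1 hr
  set u := h.val.mulVec (fun j => α (r j)) with hu
  have hr' : (h⁻¹).val.mulVec u = fun j => α (r j) := by
    rw [hu, Matrix.mulVec_mulVec, Units.inv_mul, Matrix.one_mulVec]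
  obtain ⟨i', hmax⟩ := Finite.exists_max fun i => vInf (u i)
  refine ⟨i', ?_⟩
  have h1 : 1 ≤ WithZero.exp (n : ℤ) * vInf (u i') := by
    refine (one_le_vInf_algebraMap hi).trans ?_
    rw [← congrFun hr' i, Matrix.mulVec, dotProduct]
    refine Valuation.map_sum_le _ fun j _ => ?_
    rw [map_mul]
    exact mul_le_mul' (hn (i, j)) (hmax j)
  have h2 : 1 ≤ WithZero.exp (2 * n : ℤ) * vInf (u i') ^ 2 := by
    have := one_le_pow₀ (n := 2) h1
    rwa [mul_pow, ← WithZero.exp_nsmul, nsmul_eq_mul, Nat.cast_two] at this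
  calc _ ≤ WithZero.exp (-(m + 2 * n : ℕ) : ℤ) * WithZero.exp (m : ℤ) * 1 := by
        rw [mul_one]; gcongr; exact hm ()
    _ ≤ WithZero.exp (-(m + 2 * n : ℕ) : ℤ) * WithZero.exp (m : ℤ) *
        (WithZero.exp (2 * n : ℤ) * vInf (u i') ^ 2) := by gcongr
    _ = vInf (u i') ^ 2 := by
        rw [← mul_assoc, ← WithZero.exp_add, ← WithZero.exp_add]
        have : (-(m + 2 * n : ℕ) : ℤ) + m + 2 * n = 0 := by push_cast; ring
        rw [this, WithZero.exp_zero, one_mul]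

/-- The thick parts form an increasing open cover. -/
theorem exists_subset_thickPart {K : Set (XInf F)} (hK : IsCompact K) :
    ∃ T, K ⊆ thickPart F T := by
  refine hK.elim_directed_cover _ isOpen_thickPart ?_ ?_
  · intro y _
    obtain ⟨h, rfl⟩ := isOpenQuotientMap_pt.surjective y
    obtain ⟨T, hT⟩ := exists_isThick h
    exact Set.mem_iUnion.2 ⟨T, h, hT, rfl⟩
  · exact directed_of_isDirected_le fun T T' hT => Set.image_mono fun h hh => IsThick.mono hT hh

end Compactness

/-! ### Counting returns in one period. -/

section Counting

/-- A `P`-periodic set of integers contained in `|2 e m + j| ≥ P - 1 - C` has few elements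
modulo `P`. -/
theorem card_filter_range_le {S : Set ℤ} [DecidablePred (· ∈ S)] {P C : ℕ} (hP : 0 < P) {e j : ℤ}
    (he : e = 1 ∨ e = -1) (hper : ∀ m l : ℤ, m ∈ S → m + l * P ∈ S)
    (hS : ∀ m ∈ S, (P : ℤ) - 1 - C ≤ |2 * e * m + j|) :
    ((Finset.range P).filter fun m : ℕ => (m : ℤ) ∈ S).card ≤ 2 * (C + 2) := by
  -- The residue of `2 e m + j` modulo `2P` centred at `0`, in `[-P, P)`. It is the value of the
  -- same form at a translate of `m` by a multiple of `P`, so the lower bound applies to it and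
  -- leaves two intervals of `C + 2` integers.
  set f : ℕ → ℤ := fun m => (2 * e * m + j).bmod (2 * P) with hf
  have hmaps : ∀ m ∈ (Finset.range P).filter fun m : ℕ => (m : ℤ) ∈ S,
      f m ∈ Finset.Icc (-P : ℤ) (-P + 1 + C) ∪ Finset.Icc ((P : ℤ) - 1 - C) P := by
    intro m hm
    rw [Finset.mem_filter] at hm
    have hpos : 0 < 2 * P := by omega
    have hlo := Int.le_bmod (x := 2 * e * m + j) hpos
    have hhi := Int.bmod_lt (x := 2 * e * m + j) hpos
    obtain ⟨c, hc⟩ : ((2 * P : ℕ) : ℤ) ∣ (2 * e * m + j) - f m := Int.dvd_self_sub_bmod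
    have hfm : f m = 2 * e * (m + (-e * c) * P) + j := by
      have hee : e * e = 1 := by rcases he with rfl | rfl <;> norm_num
      push_cast at hc
      linear_combination -hc + 2 * (P : ℤ) * c * hee
    have h1 := hS _ (hper m (-e * c) hm.2)
    rw [← hfm] at h1
    rw [Finset.mem_union, Finset.mem_Icc, Finset.mem_Icc]
    change _ ≤ f m at hlo
    change f m < _ at hhi
    push_cast at hlo hhi
    rcases abs_cases (f m) with ⟨h2, -⟩ | ⟨h2, -⟩ <;> rw [h2] at h1 <;> omega
  have hinj : Set.InjOn f ((Finset.range P).filter fun m : ℕ => (m : ℤ) ∈ S) := by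
    intro m hm m' hm' h
    simp only [Finset.coe_filter, Finset.mem_range, Set.mem_ofPred_eq] at hm hm'
    have h1 : ((2 * P : ℕ) : ℤ) ∣ (2 * e * m' + j) - (2 * e * m + j) := by
      have h2 : ((2 * P : ℕ) : ℤ) ∣ (2 * e * m + j) - f m := Int.dvd_self_sub_bmod
      have h3 : ((2 * P : ℕ) : ℤ) ∣ (2 * e * m' + j) - f m' := Int.dvd_self_sub_bmod
      rw [h] at h2
      have := dvd_sub h3 h2
      rwa [sub_sub_sub_cancel_right] at this
    obtain ⟨c, hc⟩ := h1
    push_cast at hc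
    have h4 : e * ((m' : ℤ) - m) = P * c := by linarith
    have h5 : (P : ℤ) ∣ (m' : ℤ) - m := by
      rcases he with rfl | rfl
      · exact ⟨c, by linarith⟩
      · exact ⟨-c, by linarith⟩
    have h6 := Int.eq_zero_of_abs_lt_dvd h5 (by rw [abs_lt]; omega)
    omega
  refine (Finset.card_le_card_of_injOn f hmaps hinj).trans ((Finset.card_union_le _ _).trans ?_)
  rw [Int.card_Icc, Int.card_Icc]
  omega

end Counting

/-! ### Measure of the thick part and escape of mass. -/

section Escape

variable {F : Type*} [Field F]

local notation "α" => algebraMap F[X] (KInf F)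

/-- By invariance, `P * μ V` is the integral over `z` of the number of `m < P` with `torus (t ^ m) •
z ∈ V`, and almost every `z` lies on the orbit, where this count is at most `B`. -/
theorem IsOrbitMeasure.mul_measure_le {y : XInf F} {μ : Measure (XInf F)}
    (h : IsOrbitMeasure y μ) {V : Set (XInf F)} (hV : MeasurableSet V) (t : (KInf F)ˣ) (P B : ℕ)
    [DecidablePred (· ∈ V)]
    (hB : ∀ u : (KInf F)ˣ,
      ((Finset.range P).filter fun m : ℕ => torus (t ^ (m : ℤ) * u) • y ∈ V).card ≤ B) :
    P * μ V ≤ B := by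
  have := h.isProbabilityMeasure
  have hm : ∀ u : (KInf F)ˣ, MeasurableSet ((fun z : XInf F => torus u • z) ⁻¹' V) := fun u =>
    (continuous_const_smul (torus u)).measurable hV
  calc (P : ENNReal) * μ V = ∑ m ∈ Finset.range P,
        μ ((fun z : XInf F => torus (t ^ (m : ℤ)) • z) ⁻¹' V) := by
        simp_rw [h.measure_preimage _ hV]
        simp
    _ = ∑ m ∈ Finset.range P, ∫⁻ z,
        ((fun z : XInf F => torus (t ^ (m : ℤ)) • z) ⁻¹' V).indicator 1 z ∂μ := by
        refine Finset.sum_congr rfl fun m _ => ?_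
        rw [lintegral_indicator_one (hm _)]
    _ = ∫⁻ z, ∑ m ∈ Finset.range P,
        ((fun z : XInf F => torus (t ^ (m : ℤ)) • z) ⁻¹' V).indicator 1 z ∂μ := by
        rw [lintegral_finsetSum _ fun m _ => measurable_one.indicator (hm _)]
    _ ≤ ∫⁻ _, (B : ENNReal) ∂μ := by
        refine lintegral_mono_ae ?_
        have h0 : ∀ᵐ z ∂μ, z ∈ MulAction.orbit (diagSubgroup F) y := by
          rw [ae_iff]; exact h.carried
        filter_upwards [h0] with z hz
        rw [orbit_diagSubgroup] at hz
        obtain ⟨u, rfl⟩ := hz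
        have e : ∀ m : ℕ, ((fun z : XInf F => torus (t ^ (m : ℤ)) • z) ⁻¹' V).indicator
            (1 : XInf F → ENNReal) (torus u • y) =
            if torus (t ^ (m : ℤ) * u) • y ∈ V then 1 else 0 := by
          intro m
          have hiff : torus u • y ∈ (fun z : XInf F => torus (t ^ (m : ℤ)) • z) ⁻¹' V ↔
              torus (t ^ (m : ℤ) * u) • y ∈ V := by
            rw [Set.mem_preimage, smul_smul, ← map_mul]
          by_cases hh : torus (t ^ (m : ℤ) * u) • y ∈ V
          · rw [if_pos hh, Set.indicator_of_mem (hiff.2 hh), Pi.one_apply]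
          · rw [if_neg hh, Set.indicator_of_notMem (fun h' => hh (hiff.1 h'))]
        simp_rw [e]
        rw [Finset.sum_boole]
        exact_mod_cast hB u
    _ = B := by simp

/-- A point of the thick part in the orbit of a lattice of small covolume with a given
vector `w` is far away in the orbit. -/
theorem le_abs_of_isThick {T κ : ℕ} {h : GL (Fin 2) (KInf F)} {w : Fin 2 → KInf F} (hw0 : w ≠ 0)
    (hw : w ∈ lattice F[X] h) (hκ : ∀ i, vInf (w i) ≤ WithZero.exp (κ : ℤ)) {u : (KInf F)ˣ} {z D : ℤ}
    (hu : vInf (u : KInf F) = WithZero.exp z)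
    (hD : WithZero.exp D ≤ vInf (h : Matrix (Fin 2) (Fin 2) (KInf F)).det)
    (hT : torus u • pt h ∈ thickPart F T) : D - (T + 2 * κ) ≤ |z| := by
  have hT' : IsThick T (diagGL u 1 * h) := pt_mem_thickPart.1 hT
  obtain ⟨r, rfl⟩ := (mem_lattice_iff _ _).1 hw
  have hr : r ≠ 0 := by
    rintro rfl
    apply hw0
    simp only [Pi.zero_apply, map_zero]
    exact Matrix.mulVec_zero _
  obtain ⟨i, hi⟩ := hT' r hr
  have hdet : (diagGL u 1 : Matrix (Fin 2) (Fin 2) (KInf F)).det = u := by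
    simp [diagGL]
  rw [Units.val_mul, Matrix.det_mul, hdet, map_mul, hu, ← Matrix.mulVec_mulVec] at hi
  set w := (h : Matrix (Fin 2) (Fin 2) (KInf F)).mulVec fun i => α (r i)
  have hle : WithZero.exp (-T : ℤ) * (WithZero.exp z * WithZero.exp D) ≤
      vInf ((diagGL u 1 : Matrix (Fin 2) (Fin 2) (KInf F)).mulVec w i) ^ 2 :=
    le_trans (by gcongr) hi
  have hbound : vInf ((diagGL u 1 : Matrix (Fin 2) (Fin 2) (KInf F)).mulVec w i) ≤
      WithZero.exp (κ + max z 0 : ℤ) := by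
    fin_cases i
    · have : (diagGL u 1 : Matrix (Fin 2) (Fin 2) (KInf F)).mulVec w 0 = w 0 * u := by
        simp [diagGL, Matrix.mulVec, dotProduct, Fin.sum_univ_two, mul_comm]
      change vInf ((diagGL u 1 : Matrix (Fin 2) (Fin 2) (KInf F)).mulVec w 0) ≤ _
      rw [this, map_mul, WithZero.exp_add, hu]
      gcongr
      · exact hκ 0
      · exact WithZero.exp_le_exp.2 (le_max_left _ _)
    · have : (diagGL u 1 : Matrix (Fin 2) (Fin 2) (KInf F)).mulVec w 1 = w 1 := by
        simp [diagGL, Matrix.mulVec, dotProduct, Fin.sum_univ_two]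
      change vInf ((diagGL u 1 : Matrix (Fin 2) (Fin 2) (KInf F)).mulVec w 1) ≤ _
      rw [this]
      refine (hκ 1).trans (WithZero.exp_le_exp.2 ?_)
      have := le_max_right z 0
      omega
  -- In logarithms this reads `-T + z + D ≤ 2 (κ + max z 0)`, and `2 max z 0 - z = |z|`.
  have := hle.trans (pow_le_pow_left' hbound 2)
  rw [← WithZero.exp_add, ← WithZero.exp_add, ← WithZero.exp_nsmul, WithZero.exp_le_exp,
    nsmul_eq_mul] at this
  push_cast at this
  rcases abs_cases z with ⟨h1, h2⟩ | ⟨h1, h2⟩ <;> rw [h1] <;>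
    rcases max_cases z 0 with ⟨h3, h4⟩ | ⟨h3, h4⟩ <;> rw [h3] at this <;> linarith

theorem isOrbitMeasure_orbitMeasure {y : XInf F} (h : ∃ μ, IsOrbitMeasure y μ) :
    IsOrbitMeasure y (orbitMeasure y) := by
  rw [orbitMeasure, dif_pos h]
  exact h.choose_spec

/-- The support of `f` lies in one thick part and `f` is bounded, so the integral is at most a
constant times the measure of that part. -/
theorem tendsto_integral_of_measure_thickPart {ι : Type*} {l : Filter ι} {μ : ι → Measure (XInf F)}
    (h : ∀ T, Tendsto (fun i => (μ i).real (thickPart F T)) l (𝓝 0))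
    (hfin : ∀ i, IsFiniteMeasure (μ i)) (f : C_c(XInf F, ℝ)) :
    Tendsto (fun i => ∫ y, f y ∂(μ i)) l (𝓝 0) := by
  obtain ⟨T, hT⟩ := exists_subset_thickPart f.hasCompactSupport.isCompact
  obtain ⟨C, hC⟩ := f.hasCompactSupport.exists_bound_of_continuous f.continuous
  have hle : ∀ i, ‖∫ y, f y ∂(μ i)‖ ≤ C * (μ i).real (thickPart F T) := by
    intro i
    have := hfin i
    rw [← setIntegral_eq_integral_of_forall_compl_eq_zero (s := thickPart F T)]
    · exact norm_setIntegral_le_of_norm_le_const (measure_lt_top _ _) fun y _ => hC y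
    · intro y hy
      exact image_eq_zero_of_notMem_tsupport fun h' => hy (hT h')
  refine squeeze_zero_norm hle ?_
  simpa using (h T).const_mul C

end Escape

theorem natDegree_X_sq_add_four {R : Type*} [CommRing R] [Nontrivial R] :
    (X ^ 2 + 4 : R[X]).natDegree = 2 := by
  have e : (X ^ 2 + 4 : R[X]) = X ^ 2 + C 4 := by rw [map_ofNat C 4]
  rw [e, natDegree_X_pow_add_C]

/-! ### Periodicity in the Hecke tree and the limit along rational rays. -/

section HeckeTree

variable {F : Type*} [Field F]

theorem isPeriodic_and_existsUnique [Finite F] {y : XInf F} {u : (KInf F)ˣ} (hu : vInf (u : KInf F) ≠ 1)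
    (hy : torus u • y = y) : IsPeriodic y ∧ ∃! μ, IsOrbitMeasure y μ := by
  suffices h : ∃ u₀ : (KInf F)ˣ, 1 < vInf (u₀ : KInf F) ∧ torus u₀ • y = y by
    obtain ⟨u₀, h1, h2⟩ := h
    exact ⟨isPeriodic_of_period h1 h2, existsUnique_isOrbitMeasure_of_period h1 h2⟩
  rcases lt_or_gt_of_ne hu with h | h
  · refine ⟨u⁻¹, ?_, ?_⟩
    · rw [Units.val_inv_eq_inv_val, map_inv₀]
      exact (one_lt_inv₀ (zero_lt_iff.2 ((Valuation.ne_zero_iff _).2 u.ne_zero))).2 h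
    · rw [map_inv, inv_smul_eq_iff, hy]
  · exact ⟨u, h, hy⟩

variable {p : ℕ} [Fact p.Prime] [CharP F p] {ν : HeightOneSpectrum F[X]}
  {g : GL (Fin 2) (KInf F)}

theorem dividesPow_one (q : F[X]) : DividesPow q 0 (1 : GL (Fin 2) (KInf F)) := by
  simpa using DividesPow.map q 1

theorem exists_period (hp : Odd p)
    (hg : Matrix.ProjGenLinGroup.mk (g * gamma0Inf F * g⁻¹) ∈ diagSubgroup F) :
    ∃ (t : (KInf F)ˣ) (e : ℤ), (e = 1 ∨ e = -1) ∧ vInf (t : KInf F) = WithZero.exp (2 * e) ∧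
      ∀ (m k : ℕ) (A : GL (Fin 2) (KInf F)), DividesPow (X ^ 2 + 4 : F[X]) m A →
        m ≤ (p ^ k - 1) / 2 → torus (t ^ p ^ k) • pt (g * A) = pt (g * A) := by
  obtain ⟨a, b, hab⟩ := exists_eq_diagGL hg
  obtain ⟨e, he, ha, hb⟩ := vInf_eigenvalues hab
  refine ⟨a / b, e, he, ?_, fun m k A hA hm => torus_pow_smul_pt p hp k hm hab hA⟩
  rw [Units.val_div_eq_div_val, map_div₀, ha, hb, ← WithZero.exp_sub]
  congr 1
  ring

theorem isPeriodic_and_existsUnique_of_reachable [Finite F] (hp : Odd p)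
    (hν : ν.asIdeal = Ideal.span {X ^ 2 + 4})
    (hg : Matrix.ProjGenLinGroup.mk (g * gamma0Inf F * g⁻¹) ∈ diagSubgroup F) {y : XInf F}
    (hy : (heckeGraph ν).Reachable (pt g) y) : IsPeriodic y ∧ ∃! μ, IsOrbitMeasure y μ := by
  obtain ⟨t, e, he, ht, hper⟩ := exists_period (p := p) hp hg
  obtain ⟨w⟩ := hy
  obtain ⟨A, hA, rfl⟩ := exists_dividesPow_of_walk hν X_sq_add_four_ne_zero w (g := g)
    (dividesPow_one _) (by rw [mul_one])
  -- Any exponent `k` with `p^k > 2 * w.length` would do; `p^k > k` makes this choice valid.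
  have hk : 0 + w.length ≤ (p ^ (2 * w.length + 1) - 1) / 2 := by
    have := Nat.lt_pow_self (Fact.out : p.Prime).one_lt (n := 2 * w.length + 1)
    omega
  refine isPeriodic_and_existsUnique ?_ (hper _ _ A hA hk)
  rw [Units.val_pow_eq_pow_val, map_pow, ht, ← WithZero.exp_nsmul, ← WithZero.exp_zero, Ne,
    WithZero.exp_inj, nsmul_eq_mul, mul_eq_zero]
  have := (Fact.out : p.Prime).ne_zero
  rcases he with rfl | rfl <;> simp [this]

theorem IsHeckeRay.exists_walk {x₀ : XInf F} {x : ℕ → XInf F} (hx : IsHeckeRay ν x₀ x) (n : ℕ) :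
    ∃ w : (heckeGraph ν).Walk x₀ (x n), w.length = n := by
  have h := hx.2 0 n
  rw [zero_add, hx.1] at h
  -- The distance between unreachable vertices is `0` by convention, so `dist = n` yields a walk
  -- only for `n > 0`.
  rcases Nat.eq_zero_or_pos n with rfl | hn
  · rw [hx.1]
    exact ⟨.nil, rfl⟩
  · have hr : (heckeGraph ν).Reachable x₀ (x n) := by
      by_contra hr
      rw [SimpleGraph.dist_eq_zero_of_not_reachable hr] at h
      omega
    obtain ⟨w, hw⟩ := hr.exists_walk_length_eq_dist
    exact ⟨w, hw.trans h⟩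

/-- The bound `B` does not depend on `k`: with `2n = p^k - 1`, the log covolume of `x_n` is at least
`p^k - 1 + δ`, which is half the logarithmic period `2 p^k` up to a constant. -/
theorem exists_bound_thickPart [Finite F] (hp : Odd p) (hν : ν.asIdeal = Ideal.span {X ^ 2 + 4})
    (hi : Irreducible (X ^ 2 + 4 : F[X]))
    (hg : Matrix.ProjGenLinGroup.mk (g * gamma0Inf F * g⁻¹) ∈ diagSubgroup F)
    {x : ℕ → XInf F} (hx : IsHeckeRay ν (pt g) x) (hr : IsRationalRay ν x) (T : ℕ) :
    ∃ B : ℕ, ∀ (k : ℕ) (μ : Measure (XInf F)), IsOrbitMeasure (x ((p ^ k - 1) / 2)) μ →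
      (p ^ k : ℕ) * μ (thickPart F T) ≤ B := by
  classical
  obtain ⟨t, e, he, ht, hper⟩ := exists_period (p := p) hp hg
  obtain ⟨h, w, hw0, hh⟩ := exists_lattices_of_ray hν hi hx hr
  obtain ⟨κ, hκ⟩ := exists_vInf_le w
  have hdet0 : (h 0 : Matrix (Fin 2) (Fin 2) (KInf F)).det ≠ 0 :=
    ((Matrix.isUnit_iff_isUnit_det _).1 (h 0).isUnit).ne_zero
  obtain ⟨δ, hδ⟩ := exists_vInf_eq _ hdet0
  -- `C` collects the losses independent of `k`: the thickness `T`, the size `κ` of the common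
  -- vector, and the initial covolume `δ`.
  set C : ℕ := (T + 2 * κ - δ).toNat with hC
  refine ⟨2 * (C + 2), fun k μ hμ => ?_⟩
  have hodd : Odd (p ^ k) := hp.pow
  have hpos : 0 < p ^ k := hodd.pos
  set n := (p ^ k - 1) / 2 with hn
  have hn2 : 2 * (n : ℤ) = (p ^ k : ℕ) - 1 := by
    obtain ⟨r, hr⟩ := hodd
    omega
  obtain ⟨hpt, hwmem, hcov⟩ := hh n
  obtain ⟨walk, hlen⟩ := hx.exists_walk n
  obtain ⟨A, hA, hxA⟩ := exists_dividesPow_of_walk hν X_sq_add_four_ne_zero walk (g := g)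
    (dividesPow_one _) (by rw [mul_one])
  have hfix : torus (t ^ p ^ k) • x n = x n := by
    rw [hxA]
    exact hper _ k A hA (by rw [hlen, zero_add])
  rw [hδ, natDegree_X_sq_add_four, ← WithZero.exp_add] at hcov
  refine hμ.mul_measure_le (isOpen_thickPart T).measurableSet t (p ^ k) _ fun u => ?_
  obtain ⟨j, hj⟩ := exists_vInf_eq _ u.ne_zero
  have hv : ∀ m : ℤ, vInf ((t ^ m * u : (KInf F)ˣ) : KInf F) = WithZero.exp (2 * e * m + j) := by
    intro m
    rw [Units.val_mul, Units.val_zpow_eq_zpow_val, map_mul, map_zpow₀, ht, hj,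
      ← WithZero.exp_zsmul, ← WithZero.exp_add, smul_eq_mul, mul_comm]
  have := card_filter_range_le (S := {m : ℤ | torus (t ^ m * u) • x n ∈ thickPart F T})
    (C := C) (j := j) hpos he ?_ ?_
  · exact this
  · intro m l hm
    have hl : torus (t ^ (l * (p ^ k : ℕ))) • x n = x n := by
      rw [mul_comm, zpow_mul, zpow_natCast]
      exact torus_zpow_smul hfix l
    change torus (t ^ (m + l * (p ^ k : ℕ)) * u) • x n ∈ thickPart F T
    rw [zpow_add, mul_right_comm, map_mul, mul_smul, hl]
    exact hm
  · intro m hm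
    have h1 := le_abs_of_isThick hw0 hwmem hκ (hv m) hcov (by rw [hpt]; exact hm)
    have h2 := Int.self_le_toNat (T + 2 * κ - δ)
    rw [← hC] at h2
    refine le_trans ?_ h1
    rw [Nat.cast_two]
    linarith

theorem tendsto_integral_orbitMeasure [Finite F] (hp : Odd p) (hν : ν.asIdeal = Ideal.span {X ^ 2 + 4})
    (hi : Irreducible (X ^ 2 + 4 : F[X]))
    (hg : Matrix.ProjGenLinGroup.mk (g * gamma0Inf F * g⁻¹) ∈ diagSubgroup F)
    {x : ℕ → XInf F} (hx : IsHeckeRay ν (pt g) x) (hr : IsRationalRay ν x) (f : C_c(XInf F, ℝ)) :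
    Tendsto (fun k : ℕ => ∫ y, f y ∂(orbitMeasure (x ((p ^ k - 1) / 2)))) atTop (𝓝 0) := by
  have hμ : ∀ n, IsOrbitMeasure (x n) (orbitMeasure (x n)) := fun n => by
    obtain ⟨w, -⟩ := hx.exists_walk n
    exact isOrbitMeasure_orbitMeasure
      (isPeriodic_and_existsUnique_of_reachable hp hν hg ⟨w⟩).2.exists
  refine tendsto_integral_of_measure_thickPart (fun T => ?_)
    (fun k => have := (hμ ((p ^ k - 1) / 2)).isProbabilityMeasure; inferInstance) f
  obtain ⟨B, hB⟩ := exists_bound_thickPart (p := p) hp hν hi hg hx hr T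
  have hp1 : (1 : ℝ) < p := by exact_mod_cast (Fact.out : p.Prime).one_lt
  have hlim : Tendsto (fun k : ℕ => (B : ℝ) / (p : ℝ) ^ k) atTop (𝓝 0) :=
    (tendsto_pow_atTop_atTop_of_one_lt hp1).const_div_atTop _
  refine squeeze_zero (fun _ => measureReal_nonneg) (fun k => ?_) hlim
  have := (hμ ((p ^ k - 1) / 2)).isProbabilityMeasure
  rw [le_div_iff₀ (by positivity), mul_comm]
  have h1 := ENNReal.toReal_mono (ENNReal.natCast_ne_top B) (hB k _ (hμ _))
  rw [ENNReal.toReal_mul, ENNReal.toReal_natCast, ENNReal.toReal_natCast, Nat.cast_pow] at h1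
  exact h1

theorem zero_mem_accPoints {x : ℕ → XInf F} {φ : ℕ → ℕ} (hφ : Tendsto φ atTop atTop)
    (h : ∀ f : C_c(XInf F, ℝ), Tendsto (fun k => ∫ y, f y ∂(orbitMeasure (x (φ k)))) atTop (𝓝 0)) :
    (0 : Measure (XInf F)) ∈ accPoints x := by
  refine ⟨inferInstance, ?_⟩
  have hlim : Tendsto ((fun (n : ℕ) (f : C_c(XInf F, ℝ)) => ∫ y, f y ∂(orbitMeasure (x n))) ∘ φ)
      atTop (𝓝 fun f : C_c(XInf F, ℝ) => ∫ y, f y ∂(0 : Measure (XInf F))) := by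
    refine tendsto_pi_nhds.2 fun f => ?_
    simpa using h f
  exact MapClusterPt.of_comp hφ hlim.mapClusterPt

end HeckeTree

/-! ### The exponents `n_k` and the irreducibility of `Y² + 4`. -/

theorem tendsto_half_pow_sub_one {p : ℕ} (hp : 1 < p) :
    Tendsto (fun k : ℕ => (p ^ k - 1) / 2) atTop atTop := by
  have h1 : Tendsto (fun n : ℕ => (n - 1) / 2) atTop atTop :=
    (Nat.tendsto_div_const_atTop two_ne_zero).comp (tendsto_sub_atTop_nat 1)
  exact h1.comp (tendsto_pow_atTop_atTop_of_one_lt hp)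

theorem odd_of_not_isSquare {p : ℕ} [Fact p.Prime] (h : ¬ IsSquare (-1 : ZMod p)) : Odd p := by
  refine (Fact.out : p.Prime).eq_two_or_odd'.resolve_left ?_
  rintro rfl
  exact h ⟨1, rfl⟩

theorem irreducible_X_sq_add_four {p : ℕ} [Fact p.Prime] (h : ¬ IsSquare (-1 : ZMod p)) :
    Irreducible (X ^ 2 + 4 : (ZMod p)[X]) := by
  have h2 : (2 : ZMod p) ≠ 0 := by
    intro h0
    refine h ⟨1, ?_⟩
    linear_combination -h0
  have hdeg := natDegree_X_sq_add_four (R := ZMod p)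
  refine (irreducible_iff_roots_eq_zero_of_degree_le_three (by rw [hdeg]) (by rw [hdeg]; norm_num)).2 ?_
  -- A root `a` of `X² + 4` would give `(a / 2)² = -1`.
  refine Multiset.eq_zero_of_forall_notMem fun a ha => h ⟨a / 2, ?_⟩
  have ha' := isRoot_of_mem_roots ha
  simp at ha'
  field_simp
  linear_combination -ha'

end HeckeEscape
end

theorem mainTheorem2 :
    (∃ (p : ℕ) (_ : Fact p.Prime) (ν : HeightOneSpectrum (ZMod p)[X])
      (x₀ : HeckeEscape.XInf (ZMod p)),
      (∀ y, (HeckeEscape.heckeGraph ν).Reachable x₀ y →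
        HeckeEscape.IsPeriodic y ∧ ∃! μ, HeckeEscape.IsOrbitMeasure y μ) ∧
      ∀ x : ℕ → HeckeEscape.XInf (ZMod p),
        HeckeEscape.IsHeckeRay ν x₀ x → HeckeEscape.IsRationalRay ν x →
          (0 : Measure (HeckeEscape.XInf (ZMod p))) ∈ HeckeEscape.accPoints x) ∧
    (∀ (p : ℕ) [Fact p.Prime], ¬ IsSquare (-1 : ZMod p) →
      Irreducible (X ^ 2 + 4 : (ZMod p)[X]) ∧
      (∃ g : GL (Fin 2) (HeckeEscape.KInf (ZMod p)),
        Matrix.ProjGenLinGroup.mk (g * HeckeEscape.gamma0Inf (ZMod p) * g⁻¹) ∈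
          HeckeEscape.diagSubgroup (ZMod p)) ∧
      ∀ ν : HeightOneSpectrum (ZMod p)[X], ν.asIdeal = Ideal.span {X ^ 2 + 4} →
        ∀ g : GL (Fin 2) (HeckeEscape.KInf (ZMod p)),
          Matrix.ProjGenLinGroup.mk (g * HeckeEscape.gamma0Inf (ZMod p) * g⁻¹) ∈
            HeckeEscape.diagSubgroup (ZMod p) →
          (∀ y, (HeckeEscape.heckeGraph ν).Reachable (HeckeEscape.pt g) y →
            HeckeEscape.IsPeriodic y ∧ ∃! μ, HeckeEscape.IsOrbitMeasure y μ) ∧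
          ∀ x : ℕ → HeckeEscape.XInf (ZMod p),
            HeckeEscape.IsHeckeRay ν (HeckeEscape.pt g) x → HeckeEscape.IsRationalRay ν x →
              (0 : Measure (HeckeEscape.XInf (ZMod p))) ∈ HeckeEscape.accPoints x ∧
              ∀ f : C_c(HeckeEscape.XInf (ZMod p), ℝ),
                Tendsto
                  (fun k : ℕ => ∫ y, f y ∂(HeckeEscape.orbitMeasure (x ((p ^ k - 1) / 2))))
                  atTop (𝓝 0)) := by
  have main : ∀ (p : ℕ) [Fact p.Prime], ¬ IsSquare (-1 : ZMod p) →
      Irreducible (X ^ 2 + 4 : (ZMod p)[X]) ∧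
      (∃ g : GL (Fin 2) (HeckeEscape.KInf (ZMod p)),
        Matrix.ProjGenLinGroup.mk (g * HeckeEscape.gamma0Inf (ZMod p) * g⁻¹) ∈
          HeckeEscape.diagSubgroup (ZMod p)) ∧
      ∀ ν : HeightOneSpectrum (ZMod p)[X], ν.asIdeal = Ideal.span {X ^ 2 + 4} →
        ∀ g : GL (Fin 2) (HeckeEscape.KInf (ZMod p)),
          Matrix.ProjGenLinGroup.mk (g * HeckeEscape.gamma0Inf (ZMod p) * g⁻¹) ∈
            HeckeEscape.diagSubgroup (ZMod p) →
          (∀ y, (HeckeEscape.heckeGraph ν).Reachable (HeckeEscape.pt g) y →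
            HeckeEscape.IsPeriodic y ∧ ∃! μ, HeckeEscape.IsOrbitMeasure y μ) ∧
          ∀ x : ℕ → HeckeEscape.XInf (ZMod p),
            HeckeEscape.IsHeckeRay ν (HeckeEscape.pt g) x → HeckeEscape.IsRationalRay ν x →
              (0 : Measure (HeckeEscape.XInf (ZMod p))) ∈ HeckeEscape.accPoints x ∧
              ∀ f : C_c(HeckeEscape.XInf (ZMod p), ℝ),
                Tendsto
                  (fun k : ℕ => ∫ y, f y ∂(HeckeEscape.orbitMeasure (x ((p ^ k - 1) / 2))))
                  atTop (𝓝 0) := by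
    intro p _ hsq
    have hp := HeckeEscape.odd_of_not_isSquare hsq
    have hi := HeckeEscape.irreducible_X_sq_add_four hsq
    refine ⟨hi, HeckeEscape.exists_diagonalization, fun ν hν g hg =>
      ⟨fun y hy => HeckeEscape.isPeriodic_and_existsUnique_of_reachable hp hν hg hy,
        fun x hx hr => ?_⟩⟩
    have hlim := HeckeEscape.tendsto_integral_orbitMeasure hp hν hi hg hx hr
    exact ⟨HeckeEscape.zero_mem_accPoints
      (HeckeEscape.tendsto_half_pow_sub_one (Fact.out : p.Prime).one_lt) hlim, hlim⟩
  refine ⟨?_, main⟩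
  -- The existence statement is witnessed by `p = 3`.
  have h3 : ¬ IsSquare (-1 : ZMod 3) := by decide
  have : Fact (Nat.Prime 3) := ⟨Nat.prime_three⟩
  obtain ⟨hi, ⟨g, hg⟩, h⟩ := main 3 h3
  let ν : HeightOneSpectrum (ZMod 3)[X] := ⟨Ideal.span {X ^ 2 + 4},
    (Ideal.span_singleton_prime hi.ne_zero).2 hi.prime, by simpa using hi.ne_zero⟩
  obtain ⟨h1, h2⟩ := h ν rfl g hg
  exact ⟨3, this, ν, HeckeEscape.pt g, h1, fun x hx hr => (h2 x hx hr).1⟩
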